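/- **Model.** Let $K,N,P,T\ge 0$ and $M\ge 1$ be integers and $\sigma>0$. Let $\mathbf{\Phi}\in\mathbb{C}^{P\times N}$ and let $\mathbf{X}\in\mathbb{C}^{M\times T}$ with $\mathbf{X}\mathbf{X}^H=\mathbf{I}_M$ be known. Let $\mathbf{H}^r\in\mathbb{C}^{K\times N}$ and $\mathbf{H}^s\in\mathbb{C}^{N\times M}$ be unknown deterministic matrices, where the scaling ambiguity is removed by fixing $[\mathbf{H}^s]_{:,1}=\mathbf{1}_N$. For $p=1,\dots,P$ one receives $$\mathbf{Y}_p=\mathbf{H}^r\,\mathrm{diag}([\mathbf{\Phi}]_{p,:})\,\mathbf{H}^s\mathbf{X}+\mathbf{W}_p ,$$ where all entries of all $\mathbf{W}_p\in\mathbb{C}^{K\times T}$ are independent circularly symmetric complex Gaussian with mean $0$ and variance $\sigma^2$. Put $[\widetilde{\mathbf{Z}}]_{k,m,p}=[\mathbf{Y}_p\mathbf{X}^H]_{k,m}$ and $[\widetilde{\mathbf{W}}]_{k,m,p}=[\mathbf{W}_p\mathbf{X}^H]_{k,m}$. For a three-way array $\mathbf{Z}$ of size $K\times M\times P$ let $\mathbf{Z}^1\in\mathbb{C}^{PM\times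 K}$ and $\mathbf{Z}^2\in\mathbb{C}^{KP\times M}$ be its unfoldings, $[\mathbf{Z}^1]_{(m-1)P+p,\,k}=[\mathbf{Z}^2]_{(p-1)K+k,\,m}=[\mathbf{Z}]_{k,m,p}$. Let $\circ$ be the Khatri–Rao (column-wise Kronecker) product, and put $\mathbf{A}=(\mathbf{H}^s)^T\circ\mathbf{\Phi}$ and $\mathbf{B}=\mathbf{\Phi}\circ\mathbf{H}^r$. Let $\mathbf{a}_k=[(\mathbf{H}^r)^T]_{:,k}$, $\mathbf{b}_m=[\mathbf{H}^s]_{:,m}$, let $\mathbf{u}=(\mathbf{a}_1,\dots,\mathbf{a}_K,\mathbf{b}_2,\dots,\mathbf{b}_M)$ be the vector of the $(K+M-1)N$ unknown complex parameters, and let $\boldsymbol\theta=(\mathbf{u},\mathbf{u}^*)$. Let $$L(\widetilde{\mathbf{Z}})=\frac{1}{(\pi\sigma^2)^{KMP}}\exp\Big\{-\frac1{\sigma^2}\sum_{k=1}^K\big\|[\widetilde{\mathbf{Z}}^1]_{:,k}-\mathbf{A}\mathbf{a}_k\big\|^2\Big\},\qquad f(\boldsymbol\theta)=\ln L(\widetilde{\mathbf{Z}}),$$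 and let $$\mathbf{\Omega}(\boldsymbol\theta)=\mathrm{E}\Big\{\Big(\frac{\partial f}{\partial\boldsymbol\theta}\Big)^H\frac{\partial f}{\partial\boldsymbol\theta}\Big\}$$ be the complex Fisher information matrix, where $\partial f/\partial\boldsymbol\theta$ is the row vector of Wirtinger derivatives. **Claim.** (1) $L$ is the probability density of $\widetilde{\mathbf{Z}}$ with respect to Lebesgue measure, the components of $\partial f/\partial\boldsymbol\theta$ are square integrable, and $$\mathbf{\Omega}(\boldsymbol\theta)=\begin{bmatrix}\mathbf{\Psi}&\mathbf{0}\\ \mathbf{0}&\mathbf{\Psi}^*\end{bmatrix},\qquad \mathbf{\Psi}=\begin{bmatrix}\mathbf{\Psi}_1&\mathbf{\Psi}_2\\ \mathbf{\Psi}_2^H&\mathbf{\Psi}_3\end{bmatrix},$$ where, for $k,k_1,k_2\in\{1,\dots,K\}$, $m,m_1,m_2\in\{2,\dots,M\}$ and $n_1,n_2\in\{1,\dots,N\}$, $$[\mathbf{\Psi}_1]_{(k_1,n_1),(k_2,n_2)}=\frac1{\sigma^2}\,\mathbf{e}_{n_1}^H\mathbf{A}^H\mathbf{A}\,\mathbf{e}_{n_2}\,\delta_{k_1,k_2},\qquad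 [\mathbf{\Psi}_3]_{(m_1,n_1),(m_2,n_2)}=\frac1{\sigma^2}\,\mathbf{e}_{n_1}^H\mathbf{B}^H\mathbf{B}\,\mathbf{e}_{n_2}\,\delta_{m_1,m_2},$$ $$[\mathbf{\Psi}_2]_{(k,n_1),(m,n_2)}=\frac1{\sigma^4}\,\mathbf{e}_{n_1}^H\mathbf{A}^H\,\mathrm{E}\big\{[\widetilde{\mathbf{W}}^1]_{:,k}[\widetilde{\mathbf{W}}^2]_{:,m}^H\big\}\,\mathbf{B}\,\mathbf{e}_{n_2}.$$ For all $k\in\{1,\dots,K\}$ and $m\in\{1,\dots,M\}$, the noise cross-covariance $\mathrm{E}\{[\widetilde{\mathbf{W}}^1]_{:,k}[\widetilde{\mathbf{W}}^2]_{:,m}^H\}$ has the entry $\sigma^2$ at the positions $\big((m-1)P+p,\,(p-1)K+k\big)$, $p=1,\dots,P$, and zeros elsewhere. (2) Suppose that $\mathbf{\Omega}(\boldsymbol\theta)$ is nonsingular. Then $\mathbf{\Psi}$ is nonsingular and $$\mathbf{\Omega}^{-1}(\boldsymbol\theta)=\begin{bmatrix}\mathbf{\Psi}^{-1}&\mathbf{0}\\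 \mathbf{0}&(\mathbf{\Psi}^{-1})^*\end{bmatrix},\qquad \mathbf{\Psi}^{-1}=\begin{bmatrix}\mathbf{CRB}_{\mathbf{H}^r}&\mathbf{K}\\ \mathbf{K}^H&\mathbf{CRB}_{\mathbf{H}^s}\end{bmatrix}$$ for some matrix $\mathbf{K}\in\mathbb{C}^{KN\times(M-1)N}$, where the Cramér–Rao bounds $\mathbf{CRB}_{\mathbf{H}^r}$ and $\mathbf{CRB}_{\mathbf{H}^s}$ are by definition the diagonal blocks of $\mathbf{\Omega}^{-1}(\boldsymbol\theta)$ that belong to $(\mathbf{a}_1,\dots,\mathbf{a}_K)$ and to $(\mathbf{b}_2,\dots,\mathbf{b}_M)$. All matrices inverted below are nonsingular, and $$\mathbf{CRB}_{\mathbf{H}^r}=\big(\mathbf{\Psi}_1-\mathbf{\Psi}_2\mathbf{\Psi}_3^{-1}\mathbf{\Psi}_2^H\big)^{-1},\qquad \mathbf{CRB}_{\mathbf{H}^s}=\big(\mathbf{\Psi}_3-\mathbf{\Psi}_2^H\mathbf{\Psi}_1^{-1}\mathbf{\Psi}_2\big)^{-1}.$$ (3) Suppose again that $\mathbf{\Omega}(\boldsymbol\theta)$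 is nonsingular. Then these matrices are lower bounds for the error covariance. If $\hat{\mathbf{v}}(\widetilde{\mathbf{Z}})$ is a measurable estimator of $\mathbf{v}=(\mathbf{a}_1,\dots,\mathbf{a}_K)$, or of $\mathbf{v}=(\mathbf{b}_2,\dots,\mathbf{b}_M)$, that is square integrable and unbiased to first order at the true channels (its mean equals $\mathbf{v}$ there, and the real derivative of its mean with respect to all of $\mathbf{u}$ equals that of $\mathbf{u}\mapsto\mathbf{v}$, as is the case for every square-integrable estimator that is unbiased near the true channels), then $\mathrm{E}\{(\hat{\mathbf{v}}-\mathbf{v})(\hat{\mathbf{v}}-\mathbf{v})^H\}-\mathbf{CRB}$ is positive semidefinite, where $\mathbf{CRB}$ is $\mathbf{CRB}_{\mathbf{H}^r}$ or $\mathbf{CRB}_{\mathbf{H}^s}$, respectively. -/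

import Mathlib

open MeasureTheory ProbabilityTheory
open scoped Matrix ComplexOrder ComplexConjugate

namespace RISChannel

noncomputable section

/-! ### Signal model -/

/-- The circularly symmetric complex Gaussian law with mean zero and variance `σ ^ 2`: real and
imaginary part are independent real Gaussians, each with variance `σ ^ 2 / 2`. -/
def complexGaussian (σ : ℝ) : Measure ℂ :=
  ((gaussianReal 0 (σ ^ 2 / 2).toNNReal).prod (gaussianReal 0 (σ ^ 2 / 2).toNNReal)).map
    Complex.measurableEquivRealProd.symm

/-- The Khatri-Rao (column-wise Kronecker) product. The row `(i, j)` stands for the row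
`(i - 1) * |J| + j` of the usual flattened form. -/
def khatriRao {I J R : Type*} (A : Matrix I R ℂ) (B : Matrix J R ℂ) : Matrix (I × J) R ℂ :=
  Matrix.of fun ij r => A ij.1 r * B ij.2 r

/-- Three-way arrays of size `K × M × P`. -/
abbrev Tensor (K M P : ℕ) : Type := Fin K → Fin M → Fin P → ℂ

/-- Mode-1 unfolding, of size `PM × K`. -/
def mode1 {K M P : ℕ} (Z : Tensor K M P) : Matrix (Fin M × Fin P) (Fin K) ℂ :=
  Matrix.of fun mp k => Z k mp.1 mp.2

/-- Mode-2 unfolding, of size `KP × M`. -/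
def mode2 {K M P : ℕ} (Z : Tensor K M P) : Matrix (Fin P × Fin K) (Fin M) ℂ :=
  Matrix.of fun pk m => Z pk.2 m pk.1

/-- The received signal `Y_p = H^r D_p(Φ) H^s X + W_p` for the `p`-th phase configuration. -/
def received {K M N P T : ℕ} (Φ : Matrix (Fin P) (Fin N) ℂ) (X : Matrix (Fin M) (Fin T) ℂ)
    (Hr : Matrix (Fin K) (Fin N) ℂ) (Hs : Matrix (Fin N) (Fin M) ℂ)
    (W : Fin P → Matrix (Fin K) (Fin T) ℂ) (p : Fin P) : Matrix (Fin K) (Fin T) ℂ :=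
  Hr * Matrix.diagonal (fun n => Φ p n) * Hs * X + W p

/-- The three-way observation whose `p`-th slice is `Y_p Xᴴ`. -/
def observation {K M N P T : ℕ} (Φ : Matrix (Fin P) (Fin N) ℂ) (X : Matrix (Fin M) (Fin T) ℂ)
    (Hr : Matrix (Fin K) (Fin N) ℂ) (Hs : Matrix (Fin N) (Fin M) ℂ)
    (W : Fin P → Matrix (Fin K) (Fin T) ℂ) : Tensor K M P :=
  fun k m p => (received Φ X Hr Hs W p * Xᴴ) k m

/-- The three-way noise array whose `p`-th slice is `W_p Xᴴ`. -/
def filteredNoise {K M P T : ℕ} (X : Matrix (Fin M) (Fin T) ℂ)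
    (W : Fin P → Matrix (Fin K) (Fin T) ℂ) : Tensor K M P :=
  fun k m p => (W p * Xᴴ) k m

/-! ### Parameters -/

/-- Index set of the unknown complex parameters: the entries `(k, n)` of `a_k = [(H^r)ᵀ]_{:,k}`,
followed by the entries `(m, n)` of the columns `b_m = [H^s]_{:,m}` other than the first one. -/
abbrev ParamIdx (K M N : ℕ) [NeZero M] : Type :=
  (Fin K × Fin N) ⊕ ({m : Fin M // m ≠ 0} × Fin N)

/-- The matrix `H^r` with parameter vector `u`. -/
def chanR {K M N : ℕ} [NeZero M] (u : ParamIdx K M N → ℂ) : Matrix (Fin K) (Fin N) ℂ :=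
  Matrix.of fun k n => u (Sum.inl (k, n))

/-- The matrix `H^s` with parameter vector `u`; its first column consists of ones. -/
def chanS {K M N : ℕ} [NeZero M] (u : ParamIdx K M N → ℂ) : Matrix (Fin N) (Fin M) ℂ :=
  Matrix.of fun n m => if h : m = 0 then 1 else u (Sum.inr (⟨m, h⟩, n))

/-- The parameter vector `(a_1, …, a_K, b_2, …, b_M)` of a pair of channel matrices. -/
def paramVec {K M N : ℕ} [NeZero M] (Hr : Matrix (Fin K) (Fin N) ℂ)
    (Hs : Matrix (Fin N) (Fin M) ℂ) : ParamIdx K M N → ℂ :=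
  Sum.elim (fun kn => Hr kn.1 kn.2) (fun mn => Hs mn.2 mn.1.1)

/-! ### Likelihood, score and Fisher information -/

/-- The likelihood of the three-way observation `Z`. -/
def likelihood {K M N P : ℕ} (σ : ℝ) (Φ : Matrix (Fin P) (Fin N) ℂ)
    (Hr : Matrix (Fin K) (Fin N) ℂ) (Hs : Matrix (Fin N) (Fin M) ℂ) (Z : Tensor K M P) : ℝ :=
  1 / (Real.pi * σ ^ 2) ^ (K * M * P) *
    Real.exp (-(1 / σ ^ 2) *
      ∑ k, ∑ i, ‖(mode1 Z - khatriRao Hsᵀ Φ * Hrᵀ) i k‖ ^ 2)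

/-- The log-likelihood of `Z` as a function of the unknown parameters. -/
def logLikelihood {K M N P : ℕ} [NeZero M] (σ : ℝ) (Φ : Matrix (Fin P) (Fin N) ℂ)
    (Z : Tensor K M P) (u : ParamIdx K M N → ℂ) : ℝ :=
  Real.log (likelihood σ Φ (chanR u) (chanS u) Z)

/-- The Wirtinger derivative `∂f/∂u_i = (∂f/∂(Re u_i) - 𝐢 ∂f/∂(Im u_i)) / 2`. -/
def wirtinger {ι : Type*} [Fintype ι] [DecidableEq ι] (f : (ι → ℂ) → ℝ) (u : ι → ℂ) (i : ι) : ℂ :=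
  ((fderiv ℝ f u (Pi.single i 1) : ℂ) - Complex.I * (fderiv ℝ f u (Pi.single i Complex.I) : ℂ)) / 2

/-- The Wirtinger derivative `∂f/∂u_i^* = (∂f/∂(Re u_i) + 𝐢 ∂f/∂(Im u_i)) / 2`. -/
def wirtingerConj {ι : Type*} [Fintype ι] [DecidableEq ι] (f : (ι → ℂ) → ℝ) (u : ι → ℂ)
    (i : ι) : ℂ :=
  ((fderiv ℝ f u (Pi.single i 1) : ℂ) + Complex.I * (fderiv ℝ f u (Pi.single i Complex.I) : ℂ)) / 2

/-- The row vector `∂f/∂θ` for `θ = (u, u^*)`, where `u` lists the unknown parameters. -/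
def score {K M N P : ℕ} [NeZero M] (σ : ℝ) (Φ : Matrix (Fin P) (Fin N) ℂ) (Z : Tensor K M P)
    (u : ParamIdx K M N → ℂ) : ParamIdx K M N ⊕ ParamIdx K M N → ℂ :=
  Sum.elim (wirtinger (logLikelihood σ Φ Z) u) (wirtingerConj (logLikelihood σ Φ Z) u)

variable {Ω : Type*} [MeasurableSpace Ω]

/-- The complex Fisher information matrix `E[(∂f/∂θ)ᴴ (∂f/∂θ)]`. -/
def fisherInfo {K M N P T : ℕ} [NeZero M] (μ : Measure Ω) (σ : ℝ)
    (Φ : Matrix (Fin P) (Fin N) ℂ) (X : Matrix (Fin M) (Fin T) ℂ)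
    (W : Ω → Fin P → Matrix (Fin K) (Fin T) ℂ)
    (Hr : Matrix (Fin K) (Fin N) ℂ) (Hs : Matrix (Fin N) (Fin M) ℂ) :
    Matrix (ParamIdx K M N ⊕ ParamIdx K M N) (ParamIdx K M N ⊕ ParamIdx K M N) ℂ :=
  Matrix.of fun i j =>
    ∫ ω, conj (score σ Φ (observation Φ X Hr Hs (W ω)) (paramVec Hr Hs) i) *
      score σ Φ (observation Φ X Hr Hs (W ω)) (paramVec Hr Hs) j ∂μ

/-- The Cramér-Rao bound for `H^r`: the block of the inverse Fisher information matrix that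
belongs to `a_1, …, a_K`. -/
def crbHr {K M N P T : ℕ} [NeZero M] (μ : Measure Ω) (σ : ℝ)
    (Φ : Matrix (Fin P) (Fin N) ℂ) (X : Matrix (Fin M) (Fin T) ℂ)
    (W : Ω → Fin P → Matrix (Fin K) (Fin T) ℂ)
    (Hr : Matrix (Fin K) (Fin N) ℂ) (Hs : Matrix (Fin N) (Fin M) ℂ) :
    Matrix (Fin K × Fin N) (Fin K × Fin N) ℂ :=
  (fisherInfo μ σ Φ X W Hr Hs)⁻¹.toBlocks₁₁.toBlocks₁₁

/-- The Cramér-Rao bound for `H^s`: the block of the inverse Fisher information matrix that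
belongs to `b_2, …, b_M`. -/
def crbHs {K M N P T : ℕ} [NeZero M] (μ : Measure Ω) (σ : ℝ)
    (Φ : Matrix (Fin P) (Fin N) ℂ) (X : Matrix (Fin M) (Fin T) ℂ)
    (W : Ω → Fin P → Matrix (Fin K) (Fin T) ℂ)
    (Hr : Matrix (Fin K) (Fin N) ℂ) (Hs : Matrix (Fin N) (Fin M) ℂ) :
    Matrix ({m : Fin M // m ≠ 0} × Fin N) ({m : Fin M // m ≠ 0} × Fin N) ℂ :=
  (fisherInfo μ σ Φ X W Hr Hs)⁻¹.toBlocks₁₁.toBlocks₂₂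

/-! ### The blocks of the Fisher information matrix -/

/-- The noise cross-covariance `E[[W̃¹]_{:,k} [W̃²]_{:,m}ᴴ]`. -/
def noiseCrossCov {K M P T : ℕ} (μ : Measure Ω) (X : Matrix (Fin M) (Fin T) ℂ)
    (W : Ω → Fin P → Matrix (Fin K) (Fin T) ℂ) (k : Fin K) (m : Fin M) :
    Matrix (Fin M × Fin P) (Fin P × Fin K) ℂ :=
  Matrix.of fun i j =>
    ∫ ω, mode1 (filteredNoise X (W ω)) i k * conj (mode2 (filteredNoise X (W ω)) j m) ∂μ

/-- The `KN × KN` block `Ψ₁`. -/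
def Psi1 {K M N P : ℕ} (σ : ℝ) (Φ : Matrix (Fin P) (Fin N) ℂ) (Hs : Matrix (Fin N) (Fin M) ℂ) :
    Matrix (Fin K × Fin N) (Fin K × Fin N) ℂ :=
  Matrix.of fun i j =>
    if i.1 = j.1 then
      (1 / (σ : ℂ) ^ 2) * ((khatriRao Hsᵀ Φ)ᴴ * khatriRao Hsᵀ Φ) i.2 j.2
    else 0

/-- The `KN × (M-1)N` block `Ψ₂`. -/
def Psi2 {K M N P T : ℕ} [NeZero M] (μ : Measure Ω) (σ : ℝ)
    (Φ : Matrix (Fin P) (Fin N) ℂ) (X : Matrix (Fin M) (Fin T) ℂ)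
    (W : Ω → Fin P → Matrix (Fin K) (Fin T) ℂ)
    (Hr : Matrix (Fin K) (Fin N) ℂ) (Hs : Matrix (Fin N) (Fin M) ℂ) :
    Matrix (Fin K × Fin N) ({m : Fin M // m ≠ 0} × Fin N) ℂ :=
  Matrix.of fun i j =>
    (1 / (σ : ℂ) ^ 4) *
      ((khatriRao Hsᵀ Φ)ᴴ * noiseCrossCov μ X W i.1 j.1.1 * khatriRao Φ Hr) i.2 j.2

/-- The `(M-1)N × (M-1)N` block `Ψ₃`. -/
def Psi3 {K M N P : ℕ} [NeZero M] (σ : ℝ) (Φ : Matrix (Fin P) (Fin N) ℂ)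
    (Hr : Matrix (Fin K) (Fin N) ℂ) :
    Matrix ({m : Fin M // m ≠ 0} × Fin N) ({m : Fin M // m ≠ 0} × Fin N) ℂ :=
  Matrix.of fun i j =>
    if i.1 = j.1 then
      (1 / (σ : ℂ) ^ 2) * ((khatriRao Φ Hr)ᴴ * khatriRao Φ Hr) i.2 j.2
    else 0

/-- The matrix `Ψ`. -/
def Psi {K M N P T : ℕ} [NeZero M] (μ : Measure Ω) (σ : ℝ)
    (Φ : Matrix (Fin P) (Fin N) ℂ) (X : Matrix (Fin M) (Fin T) ℂ)
    (W : Ω → Fin P → Matrix (Fin K) (Fin T) ℂ)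
    (Hr : Matrix (Fin K) (Fin N) ℂ) (Hs : Matrix (Fin N) (Fin M) ℂ) :
    Matrix (ParamIdx K M N) (ParamIdx K M N) ℂ :=
  Matrix.fromBlocks (Psi1 σ Φ Hs) (Psi2 μ σ Φ X W Hr Hs) (Psi2 μ σ Φ X W Hr Hs)ᴴ (Psi3 σ Φ Hr)

/-! ### Estimators -/

/-- `est` is a square-integrable estimator of the parameters `u (e i)` that is unbiased to first
order at the channels `(Hr, Hs)`: its mean equals `u ∘ e` there, and the (real) derivative of its
mean with respect to all unknown parameters equals that of `u ↦ u ∘ e`. Every square-integrable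
estimator that is unbiased in a neighbourhood of `(Hr, Hs)` has this property. -/
structure IsLocallyUnbiased {K M N P T : ℕ} [NeZero M] {ι : Type*} (μ : Measure Ω)
    (Φ : Matrix (Fin P) (Fin N) ℂ) (X : Matrix (Fin M) (Fin T) ℂ)
    (W : Ω → Fin P → Matrix (Fin K) (Fin T) ℂ)
    (Hr : Matrix (Fin K) (Fin N) ℂ) (Hs : Matrix (Fin N) (Fin M) ℂ)
    (e : ι → ParamIdx K M N) (est : Tensor K M P → ι → ℂ) : Prop where
  measurable : ∀ i, Measurable fun Z => est Z i
  memLp : ∀ i, MemLp (fun ω => est (observation Φ X Hr Hs (W ω)) i) 2 μ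
  mean_eq : ∀ i, ∫ ω, est (observation Φ X Hr Hs (W ω)) i ∂μ = paramVec Hr Hs (e i)
  deriv_mean_eq : ∀ i, HasFDerivAt
    (fun u : ParamIdx K M N → ℂ => ∫ ω, est (observation Φ X (chanR u) (chanS u) (W ω)) i ∂μ)
    (ContinuousLinearMap.proj (R := ℝ) (φ := fun _ : ParamIdx K M N => ℂ) (e i)) (paramVec Hr Hs)

/-- The error covariance matrix `E[(est - u ∘ e) (est - u ∘ e)ᴴ]`. -/
def errorCov {K M N P T : ℕ} [NeZero M] {ι : Type*} (μ : Measure Ω)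
    (Φ : Matrix (Fin P) (Fin N) ℂ) (X : Matrix (Fin M) (Fin T) ℂ)
    (W : Ω → Fin P → Matrix (Fin K) (Fin T) ℂ)
    (Hr : Matrix (Fin K) (Fin N) ℂ) (Hs : Matrix (Fin N) (Fin M) ℂ)
    (e : ι → ParamIdx K M N) (est : Tensor K M P → ι → ℂ) : Matrix ι ι ℂ :=
  Matrix.of fun i j =>
    ∫ ω, (est (observation Φ X Hr Hs (W ω)) i - paramVec Hr Hs (e i)) *
      conj (est (observation Φ X Hr Hs (W ω)) j - paramVec Hr Hs (e j)) ∂μ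

end

end RISChannel

/-!
The filtered noise `V` has entries `[V]_{k,m,p} = [W_p Xᴴ]_{k,m}`. Since the rows of `X` are
orthonormal, and the joint characteristic function of independent circularly symmetric complex
Gaussians depends on the coefficients of a linear form only through their Euclidean norm
(`integral_exp_re_sum_mul`), `V` again has independent `complexGaussian σ` entries
(`hasLaw_filteredNoise`). The observation is `V` shifted by the noise-free array, so that the
product of the Gaussian densities, shifted, is its density (`map_observation_eq_withDensity`).

The noise-free array is bilinear in the two channels. Hence, along every single coordinate of the
parameter `u`, it is affine, and the log-likelihood is the quadratic polynomial
`c ↦ f(u) + 2 Re (c s_i) - γ ‖c‖ ^ 2` (`logLikelihood_add_single`), where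
`s_i = σ⁻² ∑ x, conj V_x * A_{x,i}` and `A` is the complex Jacobian. The score is therefore
`(s, conj s)`. The moments `E[V_x conj V_y] = σ² δ` and `E[V_x V_y] = 0` give
`E[conj s_i * s_j] = σ⁻² (Aᴴ A)_{i,j}`, which is `Ψ` (`Psi_eq_jacobian`), and `E[s_i * s_j] = 0`,
which is why the Fisher information matrix is block-diagonal (`fisherInfo_eq`). If it is
nonsingular, `Ψ` is positive definite, and the formulas for the bounds are those for the inverse
of a block matrix in terms of Schur complements.

For the bound itself, moving one coordinate of `u` along a real line with parameter `t` multiplies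
the density of the observation by an exponential tilt `exp (t ξ - t ^ 2 γ)`, where
`ξ = 2 Re (c s_i)` is a real Gaussian variable (`integral_observation_add_single`). All
exponential moments of `ξ` are finite, so the mean of any square-integrable estimator may be
differentiated under the integral sign (`hasDerivAt_integral_mul_exp`), with derivative
`E[est * ξ]`. Unbiasedness to first order prescribes this derivative; the directions `c = 1` and
`c = 𝐢` together give `E[est_a * s_j] = δ` (`IsLocallyUnbiased.integral_mul_scoreVec`). The joint
Gram matrix of the estimation error and of `conj s` is positive semidefinite, and the Schur
complement of its block `Ψ` is the error covariance minus the selected block of `Ψ⁻¹`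
(`posSemidef_gram_sub_submatrix_inv`).
-/

namespace RISChannel

/-! ### Circularly symmetric complex Gaussian variables -/

instance isProbabilityMeasure_complexGaussian (σ : ℝ) :
    IsProbabilityMeasure (complexGaussian σ) :=
  Measure.isProbabilityMeasure_map Complex.measurableEquivRealProd.symm.measurable.aemeasurable

theorem integral_complexGaussian {E : Type*} [NormedAddCommGroup E] [NormedSpace ℝ E] (σ : ℝ)
    (f : ℂ → E) :
    ∫ z, f z ∂complexGaussian σ =
      ∫ x : ℝ × ℝ, f (x.1 + x.2 * Complex.I) ∂(gaussianReal 0 (σ ^ 2 / 2).toNNReal).prod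
        (gaussianReal 0 (σ ^ 2 / 2).toNNReal) := by
  rw [complexGaussian, integral_map_equiv]
  congr 1 with x
  rw [← Complex.mk_eq_add_mul_I]
  rfl

theorem charFunDual_complexGaussian (σ : ℝ) (L : StrongDual ℝ ℂ) :
    charFunDual (complexGaussian σ) L =
      Complex.exp (-(σ ^ 2 / 4 * (L 1 ^ 2 + L Complex.I ^ 2) : ℝ)) := by
  have hL : ∀ x y : ℝ, L (x + y * Complex.I) = x * L 1 + y * L Complex.I := by
    intro x y
    have h1 : ((x : ℂ) + y * Complex.I) = x • (1 : ℂ) + y • Complex.I := by simp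
    rw [h1, map_add, map_smul, map_smul, smul_eq_mul, smul_eq_mul]
  have hv : (((σ ^ 2 / 2).toNNReal : NNReal) : ℂ) = (σ : ℂ) ^ 2 / 2 := by
    have := Real.coe_toNNReal (σ ^ 2 / 2) (by positivity)
    calc (((σ ^ 2 / 2).toNNReal : NNReal) : ℂ) = (((σ ^ 2 / 2).toNNReal : ℝ) : ℂ) := rfl
      _ = _ := by rw [this]; push_cast; ring
  rw [charFunDual_apply, integral_complexGaussian]
  have hsplit : ∀ x : ℝ × ℝ, Complex.exp (L (x.1 + x.2 * Complex.I) * Complex.I) =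
      Complex.exp (L 1 * x.1 * Complex.I) * Complex.exp (L Complex.I * x.2 * Complex.I) := by
    intro x
    rw [← Complex.exp_add, hL]
    push_cast
    ring_nf
  simp_rw [hsplit]
  rw [integral_prod_mul (fun x : ℝ => Complex.exp (L 1 * x * Complex.I))
    (fun x : ℝ => Complex.exp (L Complex.I * x * Complex.I)),
    ← charFun_apply_real, ← charFun_apply_real, charFun_gaussianReal, charFun_gaussianReal,
    ← Complex.exp_add, hv]
  congr 1
  push_cast
  ring

theorem memLp_id_complexGaussian (σ : ℝ) : MemLp id 2 (complexGaussian σ) := by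
  have hg := memLp_id_gaussianReal' (μ := 0) (v := (σ ^ 2 / 2).toNNReal) 2 (by simp)
  rw [complexGaussian, memLp_map_measure_iff (by fun_prop) (by fun_prop)]
  have h1 := (hg.comp_fst (gaussianReal 0 (σ ^ 2 / 2).toNNReal)).ofReal (K := ℂ)
  have h2 := (hg.comp_snd (gaussianReal 0 (σ ^ 2 / 2).toNNReal)).ofReal (K := ℂ)
  refine (h1.add (h2.const_mul Complex.I)).ae_eq (ae_of_all _ fun x => ?_)
  change (x.1 : ℂ) + Complex.I * x.2 = Complex.mk x.1 x.2
  rw [Complex.mk_eq_add_mul_I, mul_comm]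

theorem integral_sq_gaussianReal_zero (v : NNReal) : ∫ x, x ^ 2 ∂gaussianReal 0 v = v := by
  have h := variance_eq_integral (μ := gaussianReal 0 v) (X := id) (by fun_prop)
  rw [variance_id_gaussianReal] at h
  simpa using h.symm

theorem integral_id_complexGaussian (σ : ℝ) : ∫ z, z ∂complexGaussian σ = 0 := by
  set g := gaussianReal 0 (σ ^ 2 / 2).toNNReal with hgdef
  have hg := memLp_id_gaussianReal' (μ := 0) (v := (σ ^ 2 / 2).toNNReal) 1 (by simp)
  have h1 : Integrable (fun x : ℝ × ℝ => (x.1 : ℂ)) (g.prod g) :=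
    (hg.comp_fst g).ofReal.integrable le_rfl
  have h2 : Integrable (fun x : ℝ × ℝ => (x.2 : ℂ) * Complex.I) (g.prod g) :=
    ((hg.comp_snd g).ofReal.integrable le_rfl).mul_const _
  rw [integral_complexGaussian, integral_add h1 h2, integral_mul_const,
    integral_fun_fst (fun x : ℝ => (x : ℂ)), integral_fun_snd (fun x : ℝ => (x : ℂ)),
    integral_complex_ofReal]
  simp [hgdef]

/-- The two second moments of a complex Gaussian are read off from one computation: for
`z = x + 𝐢 y` and `ε = ±1`, the mean of `z (x + ε 𝐢 y)` is `E[x ^ 2] - ε E[y ^ 2]`, because the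
mixed terms `E[x y]` vanish. -/
theorem integral_mul_complexGaussian (σ : ℝ) (ε : ℂ) :
    ∫ z : ℂ, z * (z.re + ε * z.im * Complex.I) ∂complexGaussian σ =
      (σ : ℂ) ^ 2 / 2 * (1 - ε) := by
  set g := gaussianReal 0 (σ ^ 2 / 2).toNNReal with hgdef
  have hg := memLp_id_gaussianReal' (μ := 0) (v := (σ ^ 2 / 2).toNNReal) 2 (by simp)
  have h1 : MemLp (fun x : ℝ × ℝ => (x.1 : ℂ)) 2 (g.prod g) := (hg.comp_fst g).ofReal
  have h2 : MemLp (fun x : ℝ × ℝ => (x.2 : ℂ)) 2 (g.prod g) := (hg.comp_snd g).ofReal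
  have i11 : Integrable (fun x : ℝ × ℝ => (x.1 : ℂ) * x.1) (g.prod g) := h1.integrable_mul h1
  have i22 : Integrable (fun x : ℝ × ℝ => (x.2 : ℂ) * x.2) (g.prod g) := h2.integrable_mul h2
  have i12 : Integrable (fun x : ℝ × ℝ => (x.1 : ℂ) * x.2) (g.prod g) := h1.integrable_mul h2
  have hsq : ∫ x : ℝ, (x : ℂ) * x ∂g = (σ : ℂ) ^ 2 / 2 := by
    have h := integral_sq_gaussianReal_zero (σ ^ 2 / 2).toNNReal
    rw [Real.coe_toNNReal _ (by positivity)] at h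
    have h' := congrArg (fun r : ℝ => (r : ℂ)) h
    rw [← integral_complex_ofReal] at h'
    simp only [Complex.ofReal_pow, Complex.ofReal_div, Complex.ofReal_ofNat] at h'
    simp_rw [← sq]
    exact h'
  have e11 : ∫ x : ℝ × ℝ, (x.1 : ℂ) * x.1 ∂g.prod g = (σ : ℂ) ^ 2 / 2 := by
    rw [integral_fun_fst (fun x : ℝ => (x : ℂ) * x), hsq]; simp
  have e22 : ∫ x : ℝ × ℝ, (x.2 : ℂ) * x.2 ∂g.prod g = (σ : ℂ) ^ 2 / 2 := by
    rw [integral_fun_snd (fun x : ℝ => (x : ℂ) * x), hsq]; simp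
  have e12 : ∫ x : ℝ × ℝ, (x.1 : ℂ) * x.2 ∂g.prod g = 0 := by
    rw [integral_prod_mul (fun x : ℝ => (x : ℂ)) (fun x : ℝ => (x : ℂ)),
      integral_complex_ofReal]
    simp [hgdef]
  have hexp : ∀ x : ℝ × ℝ, ((x.1 : ℂ) + x.2 * Complex.I) *
      ((((x.1 : ℂ) + x.2 * Complex.I).re : ℂ) +
        ε * ((((x.1 : ℂ) + x.2 * Complex.I).im : ℝ) : ℂ) * Complex.I) =
      (x.1 : ℂ) * x.1 + ((1 + ε) * Complex.I * ((x.1 : ℂ) * x.2) - ε * ((x.2 : ℂ) * x.2)) := by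
    intro x
    simp only [Complex.add_re, Complex.ofReal_re, Complex.mul_re, Complex.I_re, mul_zero,
      Complex.ofReal_im, Complex.I_im, sub_zero, add_zero, Complex.add_im,
      Complex.mul_im, zero_add, mul_one]
    linear_combination ((x.2 : ℂ) * ε * x.2) * Complex.I_mul_I
  rw [integral_complexGaussian]
  simp_rw [hexp]
  have j12 : Integrable (fun x : ℝ × ℝ => (1 + ε) * Complex.I * ((x.1 : ℂ) * x.2)) (g.prod g) :=
    i12.const_mul _
  have j22 : Integrable (fun x : ℝ × ℝ => ε * ((x.2 : ℂ) * x.2)) (g.prod g) := i22.const_mul _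
  rw [integral_add i11 (j12.sub' j22), integral_sub j12 j22, integral_const_mul, integral_const_mul,
    e11, e12, e22]
  ring

theorem integral_mul_self_complexGaussian (σ : ℝ) : ∫ z, z * z ∂complexGaussian σ = 0 := by
  have h := integral_mul_complexGaussian σ 1
  simpa [Complex.re_add_im] using h

theorem integral_mul_conj_complexGaussian (σ : ℝ) :
    ∫ z, z * conj z ∂complexGaussian σ = (σ : ℂ) ^ 2 := by
  have h := integral_mul_complexGaussian σ (-1)
  have hc : ∀ z : ℂ, ((z.re : ℂ) + -1 * z.im * Complex.I) = conj z := by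
    intro z
    apply Complex.ext <;> simp
  simp_rw [hc] at h
  rw [h]
  ring

/-! ### Densities of product measures -/

theorem _root_.MeasureTheory.MeasurePreserving.map_withDensity_comp {α β : Type*}
    [MeasurableSpace α] [MeasurableSpace β] {ν : Measure α} {ν' : Measure β} {g : α → β}
    (hg : MeasurePreserving g ν ν') {f : β → ENNReal} (hf : Measurable f) :
    (ν.withDensity fun x => f (g x)).map g = ν'.withDensity f := by
  ext s hs
  rw [Measure.map_apply hg.measurable hs, withDensity_apply _ (hg.measurable hs),
    withDensity_apply _ hs, hg.setLIntegral_comp_preimage hs hf]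

/-- A finite product of measures with integrable real densities has the product density. -/
theorem pi_withDensity_ofReal {ι : Type*} [Fintype ι] {α : ι → Type*}
    [∀ i, MeasurableSpace (α i)] (ν : ∀ i, Measure (α i)) [∀ i, SigmaFinite (ν i)]
    {f : ∀ i, α i → ℝ} (hf0 : ∀ i x, 0 ≤ f i x)
    (hfi : ∀ i, Integrable (f i) (ν i)) :
    Measure.pi (fun i => (ν i).withDensity fun x => ENNReal.ofReal (f i x)) =
      (Measure.pi ν).withDensity fun x => ENNReal.ofReal (∏ i, f i (x i)) := by
  have : ∀ i, SigmaFinite ((ν i).withDensity fun x => ENNReal.ofReal (f i x)) := fun i =>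
    SigmaFinite.withDensity_ofReal _
  refine Measure.pi_eq fun s hs => ?_
  have hbox : MeasurableSet (Set.univ.pi s) := MeasurableSet.univ_pi hs
  -- the indicator of a box is a product, so that the integral over the box factorizes
  have hind : ∀ x : ∀ i, α i, (Set.univ.pi s).indicator (fun x => ∏ i, f i (x i)) x =
      ∏ i, (s i).indicator (f i) (x i) := by
    intro x
    by_cases hx : x ∈ Set.univ.pi s
    · rw [Set.indicator_of_mem hx]
      exact Finset.prod_congr rfl fun i _ =>
        (Set.indicator_of_mem (hx i (Set.mem_univ i)) _).symm
    · rw [Set.indicator_of_notMem hx]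
      simp only [Set.mem_pi, Set.mem_univ, true_implies, not_forall] at hx
      obtain ⟨i, hi⟩ := hx
      exact (Finset.prod_eq_zero (Finset.mem_univ i) (Set.indicator_of_notMem hi _)).symm
  have hint : Integrable (fun x : ∀ i, α i => ∏ i, f i (x i)) (Measure.pi ν) :=
    Integrable.fintype_prod_dep hfi
  rw [withDensity_apply _ hbox, ← ofReal_integral_eq_lintegral_ofReal hint.integrableOn
    (ae_of_all _ fun x => Finset.prod_nonneg fun i _ => hf0 i _), ← integral_indicator hbox]
  simp_rw [hind]
  rw [integral_fintype_prod_eq_prod, ENNReal.ofReal_prod_of_nonneg]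
  · refine Finset.prod_congr rfl fun i _ => ?_
    rw [withDensity_apply _ (hs i), integral_indicator (hs i),
      ofReal_integral_eq_lintegral_ofReal (hfi i).integrableOn (ae_of_all _ fun x => hf0 i x)]
  · exact fun i _ => integral_nonneg fun x => Set.indicator_nonneg (fun x _ => hf0 i x) x

/-- The product of copies of one measure with an integrable density, together with the facts about
the product density that allow the statement to be iterated over nested products. -/
theorem pi_const_withDensity_ofReal (ι : Type*) [Fintype ι] {α : Type*} [MeasurableSpace α]
    (ν : Measure α) [SigmaFinite ν] {f : α → ℝ} (hf0 : ∀ x, 0 ≤ f x) (hfi : Integrable f ν) :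
    Measure.pi (fun _ : ι => ν.withDensity fun x => ENNReal.ofReal (f x)) =
        (Measure.pi fun _ : ι => ν).withDensity (fun x => ENNReal.ofReal (∏ i, f (x i))) ∧
      (∀ x : ι → α, 0 ≤ ∏ i, f (x i)) ∧
      Integrable (fun x : ι → α => ∏ i, f (x i)) (Measure.pi fun _ : ι => ν) :=
  ⟨pi_withDensity_ofReal (fun _ : ι => ν) (fun _ => hf0) fun _ => hfi,
    fun _ => Finset.prod_nonneg fun _ _ => hf0 _,
    Integrable.fintype_prod_dep (f := fun _ => f) fun _ => hfi⟩

/-- The density of `complexGaussian σ`. -/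
noncomputable def complexGaussianPDF (σ : ℝ) (z : ℂ) : ℝ :=
  1 / (Real.pi * σ ^ 2) * Real.exp (-(1 / σ ^ 2) * ‖z‖ ^ 2)

theorem measurable_complexGaussianPDF (σ : ℝ) : Measurable (complexGaussianPDF σ) := by
  unfold complexGaussianPDF
  fun_prop

theorem complexGaussianPDF_nonneg (σ : ℝ) (z : ℂ) : 0 ≤ complexGaussianPDF σ z := by
  unfold complexGaussianPDF
  have := Real.pi_pos
  positivity

theorem complexGaussian_eq_withDensity {σ : ℝ} (hσ : 0 < σ) :
    complexGaussian σ = volume.withDensity fun z => ENNReal.ofReal (complexGaussianPDF σ z) := by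
  have hv : (σ ^ 2 / 2).toNNReal ≠ 0 := by
    rw [ne_eq, Real.toNNReal_eq_zero, not_le]; positivity
  rw [complexGaussian, gaussianReal_of_var_ne_zero _ hv,
    prod_withDensity (measurable_gaussianPDF _ _) (measurable_gaussianPDF _ _),
    ← (Complex.volume_preserving_equiv_real_prod.symm
      Complex.measurableEquivRealProd).map_withDensity_comp
      (measurable_complexGaussianPDF σ).ennreal_ofReal]
  congr 1
  rw [Measure.volume_eq_prod]
  congr 1 with x
  rw [gaussianPDF, gaussianPDF, ← ENNReal.ofReal_mul (gaussianPDFReal_nonneg _ _ _)]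
  congr 1
  have hn : ‖Complex.measurableEquivRealProd.symm x‖ ^ 2 = x.1 ^ 2 + x.2 ^ 2 := by
    change ‖Complex.mk x.1 x.2‖ ^ 2 = _
    rw [← Complex.normSq_eq_norm_sq, Complex.normSq_mk]
    ring
  have hπ := Real.pi_pos
  rw [gaussianPDFReal, gaussianPDFReal, complexGaussianPDF, hn,
    Real.coe_toNNReal _ (by positivity), mul_mul_mul_comm, ← Real.exp_add, ← mul_inv,
    Real.mul_self_sqrt (by positivity)]
  congr 1
  · field_simp
  · congr 1
    field_simp
    ring

theorem integrable_complexGaussianPDF {σ : ℝ} (hσ : 0 < σ) :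
    Integrable (complexGaussianPDF σ) := by
  refine ⟨(measurable_complexGaussianPDF σ).aestronglyMeasurable, ?_⟩
  rw [hasFiniteIntegral_iff_ofReal (ae_of_all _ (complexGaussianPDF_nonneg σ)),
    ← setLIntegral_univ, ← withDensity_apply _ MeasurableSet.univ,
    ← complexGaussian_eq_withDensity hσ]
  exact measure_lt_top _ _

/-! ### Linear combinations of independent complex Gaussian variables -/

section LinearCombinations

variable {Ω ι : Type*} [MeasurableSpace Ω] {μ : Measure Ω} {σ : ℝ} {Z : ι → Ω → ℂ}

theorem memLp_of_hasLaw_complexGaussian {Z : Ω → ℂ} (hZ : HasLaw Z (complexGaussian σ) μ) :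
    MemLp Z 2 μ := by
  have h := memLp_id_complexGaussian σ
  rwa [← hZ.map_eq, memLp_map_measure_iff (by fun_prop) hZ.aemeasurable] at h

theorem integral_mul_of_iIndepFun_complexGaussian
    (hZ : ∀ j, HasLaw (Z j) (complexGaussian σ) μ) (hind : iIndepFun Z μ) (a b : ι) :
    ∫ ω, Z a ω * Z b ω ∂μ = 0 := by
  by_cases hab : a = b
  · subst hab
    have h := (hZ a).integral_comp (f := fun z : ℂ => z * z) (by fun_prop)
    rw [integral_mul_self_complexGaussian] at h
    exact h
  · rw [(hind.indepFun hab).integral_fun_mul_eq_mul_integral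
      (hZ a).aemeasurable.aestronglyMeasurable (hZ b).aemeasurable.aestronglyMeasurable,
      (hZ a).integral_eq, integral_id_complexGaussian, zero_mul]

theorem integral_mul_conj_of_iIndepFun_complexGaussian [DecidableEq ι]
    (hZ : ∀ j, HasLaw (Z j) (complexGaussian σ) μ) (hind : iIndepFun Z μ) (a b : ι) :
    ∫ ω, Z a ω * conj (Z b ω) ∂μ = if a = b then (σ : ℂ) ^ 2 else 0 := by
  by_cases hab : a = b
  · subst hab
    have h := (hZ a).integral_comp (f := fun z : ℂ => z * conj z)
      (by fun_prop)
    rw [integral_mul_conj_complexGaussian] at h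
    rw [if_pos rfl]
    exact h
  · have hi : IndepFun (Z a) (fun ω => conj (Z b ω)) μ :=
      (hind.indepFun hab).comp measurable_id Complex.continuous_conj.measurable
    rw [if_neg hab, hi.integral_fun_mul_eq_mul_integral
      (hZ a).aemeasurable.aestronglyMeasurable
      (Complex.continuous_conj.measurable.comp_aemeasurable
        (hZ b).aemeasurable).aestronglyMeasurable,
      (hZ a).integral_eq, integral_id_complexGaussian, zero_mul]

/-- The joint characteristic function of independent circularly symmetric complex Gaussians. It
depends on the coefficients `d` only through `∑ j, ‖d j‖ ^ 2`. -/
theorem integral_exp_re_sum_mul [Fintype ι] (hZ : ∀ j, HasLaw (Z j) (complexGaussian σ) μ)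
    (hind : iIndepFun Z μ) (d : ι → ℂ) :
    ∫ ω, Complex.exp (((∑ j, d j * Z j ω).re : ℂ) * Complex.I) ∂μ =
      Complex.exp (-(σ ^ 2 / 4 * ∑ j, ‖d j‖ ^ 2 : ℝ)) := by
  classical
  let L : StrongDual ℝ (ι → ℂ) := ∑ j, Complex.reCLM.comp
    ((ContinuousLinearMap.mul ℝ ℂ (d j)).comp (ContinuousLinearMap.proj (R := ℝ) j))
  have hL : ∀ z, L z = (∑ j, d j * z j).re := by
    intro z
    simp [L]
  have hlaw := hind.hasLaw_pi hZ
  have h := charFunDual_pi (μ := fun _ : ι => complexGaussian σ) L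
  rw [charFunDual_apply, ← hlaw.map_eq, integral_map hlaw.aemeasurable (by fun_prop)] at h
  simp_rw [hL] at h
  rw [h]
  simp_rw [charFunDual_complexGaussian]
  rw [← Complex.exp_sum]
  congr 1
  rw [Finset.sum_neg_distrib, ← Complex.ofReal_sum, ← Finset.mul_sum]
  congr 4 with j
  have h1 : ∀ c : ℂ,
      (L.comp (ContinuousLinearMap.single ℝ (fun _ : ι => ℂ) j)) c = (d j * c).re := by
    intro c
    rw [ContinuousLinearMap.comp_apply, hL]
    simp [Pi.single_apply]
  rw [h1, h1, ← Complex.normSq_eq_norm_sq, Complex.normSq_apply]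
  simp
  ring

end LinearCombinations

/-! ### The law of the observation -/

/-- The noise-free observation `∑ n, [H^r]_{k,n} [Φ]_{p,n} [H^s]_{n,m}`. -/
def meanTensor {K M N P : ℕ} (Φ : Matrix (Fin P) (Fin N) ℂ) (Hr : Matrix (Fin K) (Fin N) ℂ)
    (Hs : Matrix (Fin N) (Fin M) ℂ) : Tensor K M P :=
  fun k m p => ∑ n, Hr k n * Φ p n * Hs n m

/-- The entries `[W_p Xᴴ]_{k,m}` of the filtered noise as a vector indexed by triples
`(k, m, p)`. -/
def noiseVec {K M P T : ℕ} (X : Matrix (Fin M) (Fin T) ℂ)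
    (W : Fin P → Matrix (Fin K) (Fin T) ℂ) (x : Fin K × Fin M × Fin P) : ℂ :=
  filteredNoise X W x.1 x.2.1 x.2.2

section Model

variable {K M N P T : ℕ}

theorem filteredNoise_apply (X : Matrix (Fin M) (Fin T) ℂ) (W : Fin P → Matrix (Fin K) (Fin T) ℂ)
    (k : Fin K) (m : Fin M) (p : Fin P) :
    filteredNoise X W k m p = ∑ t, W p k t * conj (X m t) := by
  simp [filteredNoise, Matrix.mul_apply]

theorem observation_eq_meanTensor_add (Φ : Matrix (Fin P) (Fin N) ℂ)
    {X : Matrix (Fin M) (Fin T) ℂ} (hX : X * Xᴴ = 1) (Hr : Matrix (Fin K) (Fin N) ℂ)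
    (Hs : Matrix (Fin N) (Fin M) ℂ) (W : Fin P → Matrix (Fin K) (Fin T) ℂ) :
    observation Φ X Hr Hs W = meanTensor Φ Hr Hs + filteredNoise X W := by
  funext k m p
  simp only [observation, received, Pi.add_apply, meanTensor, filteredNoise, Matrix.add_mul,
    Matrix.add_apply]
  rw [Matrix.mul_assoc _ X, hX, Matrix.mul_one, Matrix.mul_apply]
  simp [Matrix.mul_diagonal]

theorem likelihood_eq_prod (σ : ℝ) (Φ : Matrix (Fin P) (Fin N) ℂ) (Hr : Matrix (Fin K) (Fin N) ℂ)
    (Hs : Matrix (Fin N) (Fin M) ℂ) (Z : Tensor K M P) :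
    likelihood σ Φ Hr Hs Z =
      ∏ k, ∏ m, ∏ p, complexGaussianPDF σ ((Z - meanTensor Φ Hr Hs) k m p) := by
  have hentry : ∀ k i, (mode1 Z - khatriRao Hsᵀ Φ * Hrᵀ) i k =
      (Z - meanTensor Φ Hr Hs) k i.1 i.2 := by
    intro k i
    simp only [Matrix.sub_apply, mode1, Matrix.of_apply, Matrix.mul_apply, khatriRao,
      Matrix.transpose_apply, Pi.sub_apply, meanTensor]
    congr 1
    exact Finset.sum_congr rfl fun n _ => by ring
  simp only [likelihood, hentry, complexGaussianPDF, Finset.prod_mul_distrib, Finset.prod_const,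
    Finset.card_univ, Fintype.card_fin, ← Real.exp_sum, ← Finset.mul_sum, Fintype.sum_prod_type]
  congr 1
  rw [← pow_mul, ← pow_mul, one_div, one_div, inv_pow]
  congr 2
  ring

theorem measurable_likelihood (σ : ℝ) (Φ : Matrix (Fin P) (Fin N) ℂ)
    (Hr : Matrix (Fin K) (Fin N) ℂ) (Hs : Matrix (Fin N) (Fin M) ℂ) :
    Measurable (likelihood σ Φ Hr Hs) := by
  have h : likelihood σ Φ Hr Hs = fun Z =>
      ∏ k, ∏ m, ∏ p, complexGaussianPDF σ ((Z - meanTensor Φ Hr Hs) k m p) :=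
    funext (likelihood_eq_prod σ Φ Hr Hs)
  rw [h]
  simp only [complexGaussianPDF, Pi.sub_apply]
  fun_prop

theorem likelihood_pos {σ : ℝ} (hσ : 0 < σ) (Φ : Matrix (Fin P) (Fin N) ℂ)
    (Hr : Matrix (Fin K) (Fin N) ℂ) (Hs : Matrix (Fin N) (Fin M) ℂ) (Z : Tensor K M P) :
    0 < likelihood σ Φ Hr Hs Z := by
  have := Real.pi_pos
  unfold likelihood
  positivity

/-- Multiplication by `Xᴴ` is isometric on row vectors when the rows of `X` are orthonormal. -/
theorem sum_norm_sq_vecMul {X : Matrix (Fin M) (Fin T) ℂ} (hX : X * Xᴴ = 1) (c : Fin M → ℂ) :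
    ∑ t, ‖∑ m, c m * conj (X m t)‖ ^ 2 = ∑ m, ‖c m‖ ^ 2 := by
  have hXe : ∀ a b, ∑ t, X a t * conj (X b t) = if a = b then 1 else 0 := by
    intro a b
    have h := congrFun (congrFun hX a) b
    rw [Matrix.mul_apply, Matrix.one_apply] at h
    exact h
  have h : ((∑ t, ‖∑ m, c m * conj (X m t)‖ ^ 2 : ℝ) : ℂ) = ((∑ m, ‖c m‖ ^ 2 : ℝ) : ℂ) := by
    push_cast
    simp_rw [← Complex.mul_conj', map_sum, map_mul, Complex.conj_conj, Finset.sum_mul_sum]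
    rw [Finset.sum_comm]
    refine Finset.sum_congr rfl fun a _ => ?_
    rw [Finset.sum_comm]
    calc ∑ b, ∑ t, c a * conj (X a t) * (conj (c b) * X b t)
        = ∑ b, c a * conj (c b) * ∑ t, X b t * conj (X a t) := by
          refine Finset.sum_congr rfl fun b _ => ?_
          rw [Finset.mul_sum]
          exact Finset.sum_congr rfl fun t _ => by ring
      _ = c a * conj (c a) := by simp [hXe]
  exact_mod_cast h

variable {Ω : Type*} [MeasurableSpace Ω] {μ : Measure Ω} {σ : ℝ}
  {X : Matrix (Fin M) (Fin T) ℂ} {W : Ω → Fin P → Matrix (Fin K) (Fin T) ℂ}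

theorem aemeasurable_filteredNoise
    (hWlaw : ∀ p k t, HasLaw (fun ω => W ω p k t) (complexGaussian σ) μ) :
    AEMeasurable (fun ω => filteredNoise X (W ω)) μ := by
  refine aemeasurable_pi_lambda _ fun k => aemeasurable_pi_lambda _ fun m =>
    aemeasurable_pi_lambda _ fun p => ?_
  simp_rw [filteredNoise_apply]
  exact Finset.aemeasurable_fun_sum _ fun t _ => (hWlaw p k t).aemeasurable.mul_const _

theorem integral_exp_re_sum_filteredNoise (hX : X * Xᴴ = 1)
    (hWlaw : ∀ p k t, HasLaw (fun ω => W ω p k t) (complexGaussian σ) μ)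
    (hWindep : iIndepFun (fun (i : Fin P × Fin K × Fin T) ω => W ω i.1 i.2.1 i.2.2) μ)
    (d : Tensor K M P) :
    ∫ ω, Complex.exp (((∑ k, ∑ m, ∑ p, d k m p * filteredNoise X (W ω) k m p).re : ℂ) *
      Complex.I) ∂μ = Complex.exp (-(σ ^ 2 / 4 * ∑ k, ∑ m, ∑ p, ‖d k m p‖ ^ 2 : ℝ)) := by
  have h := integral_exp_re_sum_mul (fun i : Fin P × Fin K × Fin T => hWlaw i.1 i.2.1 i.2.2)
    hWindep (fun i => ∑ m, d i.2.1 m i.1 * conj (X m i.2.2))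
  have h1 : ∀ ω, ∑ i : Fin P × Fin K × Fin T,
      (∑ m, d i.2.1 m i.1 * conj (X m i.2.2)) * W ω i.1 i.2.1 i.2.2 =
      ∑ k, ∑ m, ∑ p, d k m p * filteredNoise X (W ω) k m p := by
    intro ω
    simp_rw [Fintype.sum_prod_type, filteredNoise_apply, Finset.sum_mul, Finset.mul_sum]
    rw [Finset.sum_comm]
    refine Finset.sum_congr rfl fun k _ => ?_
    conv_rhs => rw [Finset.sum_comm]
    refine Finset.sum_congr rfl fun p _ => ?_
    rw [Finset.sum_comm]
    exact Finset.sum_congr rfl fun m _ => Finset.sum_congr rfl fun t _ => by ring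
  have h2 : ∑ i : Fin P × Fin K × Fin T, ‖∑ m, d i.2.1 m i.1 * conj (X m i.2.2)‖ ^ 2 =
      ∑ k, ∑ m, ∑ p, ‖d k m p‖ ^ 2 := by
    simp_rw [Fintype.sum_prod_type, sum_norm_sq_vecMul hX]
    rw [Finset.sum_comm]
    exact Finset.sum_congr rfl fun k _ => Finset.sum_comm
  simp_rw [h1] at h
  rw [h, h2]

/-- The filtered noise has the same law as the unfiltered one: its entries are independent and
circularly symmetric with variance `σ ^ 2`. -/
theorem hasLaw_filteredNoise [IsProbabilityMeasure μ] (hX : X * Xᴴ = 1)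
    (hWlaw : ∀ p k t, HasLaw (fun ω => W ω p k t) (complexGaussian σ) μ)
    (hWindep : iIndepFun (fun (i : Fin P × Fin K × Fin T) ω => W ω i.1 i.2.1 i.2.2) μ) :
    HasLaw (fun ω => filteredNoise X (W ω))
      (Measure.pi fun _ : Fin K => Measure.pi fun _ : Fin M => Measure.pi fun _ : Fin P =>
        complexGaussian σ) μ where
  aemeasurable := aemeasurable_filteredNoise hWlaw
  map_eq := by
    have hmeas := aemeasurable_filteredNoise (X := X) hWlaw
    have := Measure.isProbabilityMeasure_map hmeas
    refine Measure.ext_of_charFunDual (funext fun L => ?_)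
    let E : Fin K → Fin M → Fin P → ℂ → Tensor K M P := fun k m p c =>
      Pi.single k (Pi.single m (Pi.single p c))
    -- the coefficients of `L` with respect to the complex coordinates
    let d : Tensor K M P := fun k m p => L (E k m p 1) - L (E k m p Complex.I) * Complex.I
    have hE : ∀ k m p c, L (E k m p c) = (d k m p * c).re := by
      intro k m p c
      have hc : E k m p c = c.re • E k m p 1 + c.im • E k m p Complex.I := by
        simp only [E, ← Pi.single_smul, ← Pi.single_add]
        congr 3
        simp [Complex.re_add_im]
      rw [hc, map_add, map_smul, map_smul]
      simp [d]
      ring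
    have hL : ∀ Z : Tensor K M P, L Z = (∑ k, ∑ m, ∑ p, d k m p * Z k m p).re := by
      intro Z
      have hZ : Z = ∑ k, ∑ m, ∑ p, E k m p (Z k m p) := by
        funext k m p
        simp [E, Finset.sum_apply, Pi.single_apply, ite_apply]
      conv_lhs => rw [hZ]
      simp only [map_sum, hE, Complex.re_sum]
    have hn : ∀ k m p, ‖d k m p‖ ^ 2 = L (E k m p 1) ^ 2 + L (E k m p Complex.I) ^ 2 := by
      intro k m p
      rw [← Complex.normSq_eq_norm_sq, Complex.normSq_apply]
      simp [d]
      ring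
    rw [charFunDual_apply, integral_map hmeas (by fun_prop)]
    simp_rw [hL]
    rw [integral_exp_re_sum_filteredNoise hX hWlaw hWindep]
    simp_rw [charFunDual_pi, charFunDual_complexGaussian, ← Complex.exp_sum]
    congr 1
    simp_rw [hn, Finset.mul_sum]
    push_cast
    simp only [Finset.sum_neg_distrib]
    rfl

theorem pi_complexGaussian_eq_withDensity (hσ : 0 < σ) :
    (Measure.pi fun _ : Fin K => Measure.pi fun _ : Fin M => Measure.pi fun _ : Fin P =>
      complexGaussian σ) = (volume : Measure (Tensor K M P)).withDensity
        fun Z => ENNReal.ofReal (∏ k, ∏ m, ∏ p, complexGaussianPDF σ (Z k m p)) := by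
  obtain ⟨e1, h1, i1⟩ := pi_const_withDensity_ofReal (Fin P) (volume : Measure ℂ)
    (complexGaussianPDF_nonneg σ) (integrable_complexGaussianPDF hσ)
  obtain ⟨e2, h2, i2⟩ := pi_const_withDensity_ofReal (Fin M) _ h1 i1
  obtain ⟨e3, -, -⟩ := pi_const_withDensity_ofReal (Fin K) _ h2 i2
  rw [complexGaussian_eq_withDensity hσ, e1, e2, e3]
  rfl

theorem map_observation_eq_withDensity [IsProbabilityMeasure μ] (hσ : 0 < σ) (hX : X * Xᴴ = 1)
    (hWlaw : ∀ p k t, HasLaw (fun ω => W ω p k t) (complexGaussian σ) μ)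
    (hWindep : iIndepFun (fun (i : Fin P × Fin K × Fin T) ω => W ω i.1 i.2.1 i.2.2) μ)
    (Φ : Matrix (Fin P) (Fin N) ℂ) (Hr : Matrix (Fin K) (Fin N) ℂ)
    (Hs : Matrix (Fin N) (Fin M) ℂ) :
    μ.map (fun ω => observation Φ X Hr Hs (W ω)) =
      (volume : Measure (Tensor K M P)).withDensity
        (fun Z => ENNReal.ofReal (likelihood σ Φ Hr Hs Z)) := by
  have hobs : (fun ω => observation Φ X Hr Hs (W ω)) =
      (fun Z => meanTensor Φ Hr Hs + Z) ∘ fun ω => filteredNoise X (W ω) := by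
    funext ω
    exact observation_eq_meanTensor_add Φ hX Hr Hs (W ω)
  rw [hobs, ← AEMeasurable.map_map_of_aemeasurable (by fun_prop)
    (aemeasurable_filteredNoise hWlaw), (hasLaw_filteredNoise hX hWlaw hWindep).map_eq,
    pi_complexGaussian_eq_withDensity hσ]
  have : (volume : Measure (Fin P → ℂ)).IsAddLeftInvariant := inferInstance
  have : (volume : Measure (Fin M → Fin P → ℂ)).IsAddLeftInvariant := inferInstance
  have : (volume : Measure (Tensor K M P)).IsAddLeftInvariant := inferInstance
  have htr := (measurePreserving_add_left (volume : Measure (Tensor K M P))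
    (meanTensor Φ Hr Hs)).map_withDensity_comp (measurable_likelihood σ Φ Hr Hs).ennreal_ofReal
  rw [← htr]
  congr 2 with Z
  rw [likelihood_eq_prod, add_sub_cancel_left]

/-! ### Second moments of the filtered noise -/

theorem memLp_noiseVec
    (hWlaw : ∀ p k t, HasLaw (fun ω => W ω p k t) (complexGaussian σ) μ)
    (x : Fin K × Fin M × Fin P) : MemLp (fun ω => noiseVec X (W ω) x) 2 μ := by
  simp only [noiseVec, filteredNoise_apply]
  exact memLp_finsetSum _ fun t _ =>
    (memLp_of_hasLaw_complexGaussian (hWlaw x.2.2 x.1 t)).mul_const _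

theorem integral_noiseVec [IsProbabilityMeasure μ]
    (hWlaw : ∀ p k t, HasLaw (fun ω => W ω p k t) (complexGaussian σ) μ)
    (x : Fin K × Fin M × Fin P) : ∫ ω, noiseVec X (W ω) x ∂μ = 0 := by
  simp only [noiseVec, filteredNoise_apply]
  rw [integral_finsetSum _ fun t _ => ((memLp_of_hasLaw_complexGaussian
    (hWlaw x.2.2 x.1 t)).integrable one_le_two).mul_const _]
  refine Finset.sum_eq_zero fun t _ => ?_
  rw [integral_mul_const, (hWlaw x.2.2 x.1 t).integral_eq, integral_id_complexGaussian, zero_mul]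

theorem integral_noiseVec_mul
    (hWlaw : ∀ p k t, HasLaw (fun ω => W ω p k t) (complexGaussian σ) μ)
    (hWindep : iIndepFun (fun (i : Fin P × Fin K × Fin T) ω => W ω i.1 i.2.1 i.2.2) μ)
    (x y : Fin K × Fin M × Fin P) :
    ∫ ω, noiseVec X (W ω) x * noiseVec X (W ω) y ∂μ = 0 := by
  have hm := fun p k t => memLp_of_hasLaw_complexGaussian (hWlaw p k t)
  have hterm := integral_mul_of_iIndepFun_complexGaussian
    (fun i : Fin P × Fin K × Fin T => hWlaw i.1 i.2.1 i.2.2) hWindep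
  have hi : ∀ t t', Integrable (fun ω => W ω x.2.2 x.1 t * conj (X x.2.1 t) *
      (W ω y.2.2 y.1 t' * conj (X y.2.1 t'))) μ := fun t t' =>
    ((hm _ _ t).mul_const _).integrable_mul ((hm _ _ t').mul_const _)
  simp only [noiseVec, filteredNoise_apply, Finset.sum_mul_sum]
  rw [integral_finsetSum _ fun t _ => integrable_finsetSum _ fun t' _ => hi t t']
  refine Finset.sum_eq_zero fun t _ => ?_
  rw [integral_finsetSum _ fun t' _ => hi t t']
  refine Finset.sum_eq_zero fun t' _ => ?_
  have h := hterm (x.2.2, x.1, t) (y.2.2, y.1, t')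
  simp_rw [mul_mul_mul_comm]
  rw [integral_mul_const, h, zero_mul]

theorem integral_noiseVec_mul_conj (hX : X * Xᴴ = 1)
    (hWlaw : ∀ p k t, HasLaw (fun ω => W ω p k t) (complexGaussian σ) μ)
    (hWindep : iIndepFun (fun (i : Fin P × Fin K × Fin T) ω => W ω i.1 i.2.1 i.2.2) μ)
    (x y : Fin K × Fin M × Fin P) :
    ∫ ω, noiseVec X (W ω) x * conj (noiseVec X (W ω) y) ∂μ =
      if x = y then (σ : ℂ) ^ 2 else 0 := by
  have hm := fun p k t => memLp_of_hasLaw_complexGaussian (hWlaw p k t)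
  have hterm := integral_mul_conj_of_iIndepFun_complexGaussian
    (fun i : Fin P × Fin K × Fin T => hWlaw i.1 i.2.1 i.2.2) hWindep
  have hi : ∀ t t', Integrable (fun ω => W ω x.2.2 x.1 t * conj (X x.2.1 t) *
      (conj (W ω y.2.2 y.1 t') * X y.2.1 t')) μ := fun t t' =>
    ((hm _ _ t).mul_const _).integrable_mul ((hm _ _ t').star.mul_const _)
  simp only [noiseVec, filteredNoise_apply, map_sum, map_mul, Complex.conj_conj,
    Finset.sum_mul_sum]
  rw [integral_finsetSum _ fun t _ => integrable_finsetSum _ fun t' _ => hi t t']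
  have hval : ∀ t t', ∫ ω, W ω x.2.2 x.1 t * conj (X x.2.1 t) *
      (conj (W ω y.2.2 y.1 t') * X y.2.1 t') ∂μ =
      if x.2.2 = y.2.2 ∧ x.1 = y.1 ∧ t = t' then
        (σ : ℂ) ^ 2 * (X y.2.1 t' * conj (X x.2.1 t)) else 0 := by
    intro t t'
    have h := hterm (x.2.2, x.1, t) (y.2.2, y.1, t')
    have e : ∀ ω, W ω x.2.2 x.1 t * conj (X x.2.1 t) * (conj (W ω y.2.2 y.1 t') * X y.2.1 t') =
        W ω x.2.2 x.1 t * conj (W ω y.2.2 y.1 t') * (conj (X x.2.1 t) * X y.2.1 t') :=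
      fun ω => mul_mul_mul_comm _ _ _ _
    rw [integral_congr_ae (ae_of_all μ e), integral_mul_const, h]
    simp only [Prod.mk.injEq, ite_mul, zero_mul]
    congr 1
    ring
  have hsum : ∀ t, ∫ ω, ∑ t', W ω x.2.2 x.1 t * conj (X x.2.1 t) *
      (conj (W ω y.2.2 y.1 t') * X y.2.1 t') ∂μ =
      if x.2.2 = y.2.2 ∧ x.1 = y.1 then
        (σ : ℂ) ^ 2 * (X y.2.1 t * conj (X x.2.1 t)) else 0 := by
    intro t
    rw [integral_finsetSum _ fun t' _ => hi t t']
    simp_rw [hval]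
    by_cases h1 : x.2.2 = y.2.2 <;> by_cases h2 : x.1 = y.1 <;> simp [h1, h2]
  simp_rw [hsum]
  have hXe : ∑ t, X y.2.1 t * conj (X x.2.1 t) = if y.2.1 = x.2.1 then 1 else 0 := by
    have h := congrFun (congrFun hX y.2.1) x.2.1
    rw [Matrix.mul_apply, Matrix.one_apply] at h
    exact h
  by_cases h : x.2.2 = y.2.2 ∧ x.1 = y.1
  · simp only [if_pos h, ← Finset.mul_sum, hXe]
    simp [Prod.ext_iff, h, eq_comm]
  · simp only [if_neg h, Finset.sum_const_zero]
    rw [if_neg]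
    rintro rfl
    exact h ⟨rfl, rfl⟩

end Model

/-! ### The score -/

/-- The complex Jacobian of the noise-free observation with respect to the unknown parameters: in
the column of an entry of `a_k` it carries a column of `(H^s)ᵀ ∘ Φ`, in the column of an entry of
`b_m` a column of `Φ ∘ H^r`. -/
def jacobian {K M N P : ℕ} [NeZero M] (Φ : Matrix (Fin P) (Fin N) ℂ)
    (Hr : Matrix (Fin K) (Fin N) ℂ) (Hs : Matrix (Fin N) (Fin M) ℂ) :
    Matrix (Fin K × Fin M × Fin P) (ParamIdx K M N) ℂ :=
  Matrix.of fun x => Sum.elim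
    (fun kn => if x.1 = kn.1 then khatriRao Hsᵀ Φ (x.2.1, x.2.2) kn.2 else 0)
    (fun mn => if x.2.1 = mn.1.1 then khatriRao Φ Hr (x.2.2, x.1) mn.2 else 0)

/-- The Wirtinger derivatives `∂f/∂u_i` of the log-likelihood, in terms of the residual `V`, which
is the observation minus its mean, and the complex Jacobian `A` of that mean. The derivatives
`∂f/∂u_i^*` are their conjugates. -/
noncomputable def scoreVec {I J : Type*} [Fintype I] (σ : ℝ) (A : Matrix I J ℂ) (V : I → ℂ)
    (i : J) : ℂ :=
  1 / (σ : ℂ) ^ 2 * ∑ x, conj (V x) * A x i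

section Score

variable {K M N P T : ℕ}

theorem observation_sub_meanTensor (Φ : Matrix (Fin P) (Fin N) ℂ)
    {X : Matrix (Fin M) (Fin T) ℂ} (hX : X * Xᴴ = 1) (Hr : Matrix (Fin K) (Fin N) ℂ)
    (Hs : Matrix (Fin N) (Fin M) ℂ) (W : Fin P → Matrix (Fin K) (Fin T) ℂ) :
    (fun x : Fin K × Fin M × Fin P =>
      (observation Φ X Hr Hs W - meanTensor Φ Hr Hs) x.1 x.2.1 x.2.2) = noiseVec X W := by
  rw [observation_eq_meanTensor_add Φ hX, add_sub_cancel_left]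
  rfl

variable [NeZero M]

theorem chanR_paramVec (Hr : Matrix (Fin K) (Fin N) ℂ) (Hs : Matrix (Fin N) (Fin M) ℂ) :
    chanR (paramVec Hr Hs) = Hr := rfl

theorem chanS_paramVec (Hr : Matrix (Fin K) (Fin N) ℂ) {Hs : Matrix (Fin N) (Fin M) ℂ}
    (hHs : ∀ n, Hs n 0 = 1) : chanS (paramVec Hr Hs) = Hs := by
  ext n m
  by_cases h : m = 0
  · subst h
    simp [chanS, hHs]
  · simp [chanS, paramVec, h]

/-- The noise-free observation is bilinear in the two channels, hence affine in each single
parameter. -/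
theorem meanTensor_add_single (Φ : Matrix (Fin P) (Fin N) ℂ) (u : ParamIdx K M N → ℂ)
    (i : ParamIdx K M N) (c : ℂ) (k : Fin K) (m : Fin M) (p : Fin P) :
    meanTensor Φ (chanR (u + Pi.single i c)) (chanS (u + Pi.single i c)) k m p =
      meanTensor Φ (chanR u) (chanS u) k m p +
        c * jacobian Φ (chanR u) (chanS u) (k, m, p) i := by
  rcases i with ⟨k', n'⟩ | ⟨m', n'⟩
  · have hS : chanS (u + Pi.single (Sum.inl (k', n')) c) = chanS u := by
      ext n m
      simp [chanS]
    have hR : ∀ n, chanR (u + Pi.single (Sum.inl (k', n')) c) k n =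
        chanR u k n + if k = k' ∧ n = n' then c else 0 := by
      intro n
      simp [chanR, Pi.single_apply]
    simp only [meanTensor, hS, hR, add_mul, Finset.sum_add_distrib, jacobian, khatriRao,
      Matrix.of_apply, Sum.elim_inl, Matrix.transpose_apply]
    congr 1
    by_cases hk : k = k'
    · simp [hk]
      ring
    · simp [hk]
  · have hR : chanR (u + Pi.single (Sum.inr (m', n')) c) = chanR u := by
      ext k n
      simp [chanR]
    have hS : ∀ n, chanS (u + Pi.single (Sum.inr (m', n')) c) n m =
        chanS u n m + if m = m'.1 ∧ n = n' then c else 0 := by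
      intro n
      by_cases hm : m = 0
      · have : m ≠ m'.1 := fun h => m'.2 (h ▸ hm)
        simp [chanS, hm, Ne.symm m'.2]
      · simp [chanS, hm, Pi.single_apply, Subtype.ext_iff]
    simp only [meanTensor, hS, hR, mul_add, Finset.sum_add_distrib, jacobian, khatriRao,
      Matrix.of_apply, Sum.elim_inr]
    congr 1
    by_cases hm : m = m'.1
    · simp [hm]
      ring
    · simp [hm]

theorem logLikelihood_eq (σ : ℝ) (hσ : 0 < σ) (Φ : Matrix (Fin P) (Fin N) ℂ) (Z : Tensor K M P)
    (u : ParamIdx K M N → ℂ) :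
    logLikelihood σ Φ Z u = (K * M * P : ℕ) * Real.log (1 / (Real.pi * σ ^ 2)) -
      1 / σ ^ 2 * ∑ x : Fin K × Fin M × Fin P,
        ‖(Z - meanTensor Φ (chanR u) (chanS u)) x.1 x.2.1 x.2.2‖ ^ 2 := by
  have hπ := Real.pi_pos
  have hexp : likelihood σ Φ (chanR u) (chanS u) Z = (1 / (Real.pi * σ ^ 2)) ^ (K * M * P) *
      Real.exp (-(1 / σ ^ 2) * ∑ x : Fin K × Fin M × Fin P,
        ‖(Z - meanTensor Φ (chanR u) (chanS u)) x.1 x.2.1 x.2.2‖ ^ 2) := by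
    rw [likelihood_eq_prod]
    simp only [complexGaussianPDF, Finset.prod_mul_distrib, Finset.prod_const,
      Finset.card_univ, Fintype.card_fin, ← Real.exp_sum, ← Finset.mul_sum,
      Fintype.sum_prod_type]
    rw [← pow_mul, ← pow_mul]
    congr 2
    ring
  rw [logLikelihood, hexp, Real.log_mul (by positivity) (Real.exp_ne_zero _), Real.log_pow,
    Real.log_exp]
  ring

theorem norm_sub_mul_sq (r c a : ℂ) :
    ‖r - c * a‖ ^ 2 = ‖r‖ ^ 2 - 2 * (c * (conj r * a)).re + ‖c‖ ^ 2 * ‖a‖ ^ 2 := by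
  simp only [← Complex.normSq_eq_norm_sq, Complex.normSq_apply, Complex.sub_re, Complex.sub_im,
    Complex.mul_re, Complex.mul_im, Complex.conj_re, Complex.conj_im]
  ring

/-- Along a coordinate direction the log-likelihood is a quadratic polynomial, whose linear part
is the score. -/
theorem logLikelihood_add_single {σ : ℝ} (hσ : 0 < σ) (Φ : Matrix (Fin P) (Fin N) ℂ)
    (Z : Tensor K M P) (u : ParamIdx K M N → ℂ) (i : ParamIdx K M N) (c : ℂ) :
    logLikelihood σ Φ Z (u + Pi.single i c) = logLikelihood σ Φ Z u +
      2 * (c * scoreVec σ (jacobian Φ (chanR u) (chanS u))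
        (fun x => (Z - meanTensor Φ (chanR u) (chanS u)) x.1 x.2.1 x.2.2) i).re -
      ‖c‖ ^ 2 * (1 / σ ^ 2 * ∑ x, ‖jacobian Φ (chanR u) (chanS u) x i‖ ^ 2) := by
  set R : Fin K × Fin M × Fin P → ℂ :=
    fun x => (Z - meanTensor Φ (chanR u) (chanS u)) x.1 x.2.1 x.2.2
  set A := jacobian Φ (chanR u) (chanS u)
  have hres : ∀ x : Fin K × Fin M × Fin P,
      ‖(Z - meanTensor Φ (chanR (u + Pi.single i c)) (chanS (u + Pi.single i c)) :
        Tensor K M P) x.1 x.2.1 x.2.2‖ ^ 2 =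
      ‖R x‖ ^ 2 - 2 * (c * (conj (R x) * A x i)).re + ‖c‖ ^ 2 * ‖A x i‖ ^ 2 := by
    intro x
    have h1 : (Z - meanTensor Φ (chanR (u + Pi.single i c)) (chanS (u + Pi.single i c)) :
        Tensor K M P) x.1 x.2.1 x.2.2 = R x - c * A x i := by
      simp only [Pi.sub_apply, meanTensor_add_single, R, A]
      ring
    rw [h1, norm_sub_mul_sq]
  have hs : (c * scoreVec σ A R i).re = 1 / σ ^ 2 * ∑ x, (c * (conj (R x) * A x i)).re := by
    rw [← Complex.re_sum, ← Finset.mul_sum, ← Complex.re_ofReal_mul, scoreVec]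
    congr 1
    push_cast
    ring
  rw [logLikelihood_eq σ hσ, logLikelihood_eq σ hσ, hs]
  simp_rw [hres]
  rw [Finset.sum_add_distrib, Finset.sum_sub_distrib, ← Finset.mul_sum, ← Finset.mul_sum]
  ring

theorem differentiable_logLikelihood {σ : ℝ} (hσ : 0 < σ) (Φ : Matrix (Fin P) (Fin N) ℂ)
    (Z : Tensor K M P) : Differentiable ℝ (logLikelihood σ Φ Z) := by
  have hR : ∀ k n, Differentiable ℝ fun u : ParamIdx K M N → ℂ => chanR u k n := fun k n =>
    differentiable_apply (Sum.inl (k, n))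
  have hS : ∀ n m, Differentiable ℝ fun u : ParamIdx K M N → ℂ => chanS u n m := by
    intro n m
    by_cases h : m = 0
    · simp [chanS, h]
    · simpa [chanS, h] using
        differentiable_apply (𝕜 := ℝ) (F' := fun _ : ParamIdx K M N => ℂ) (Sum.inr (⟨m, h⟩, n))
  rw [show logLikelihood σ Φ Z = _ from funext fun u => logLikelihood_eq σ hσ Φ Z u]
  refine Differentiable.const_sub (Differentiable.const_mul (Differentiable.fun_sum
    fun x _ => Differentiable.norm_sq ℝ ?_) _) _
  simp only [Pi.sub_apply, meanTensor]
  exact (Differentiable.fun_sum fun n _ => ((hR _ n).mul_const _).mul (hS n _)).const_sub _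

theorem fderiv_logLikelihood_single {σ : ℝ} (hσ : 0 < σ) (Φ : Matrix (Fin P) (Fin N) ℂ)
    (Z : Tensor K M P) (u : ParamIdx K M N → ℂ) (i : ParamIdx K M N) (c : ℂ) :
    fderiv ℝ (logLikelihood σ Φ Z) u (Pi.single i c) =
      2 * (c * scoreVec σ (jacobian Φ (chanR u) (chanS u))
        (fun x => (Z - meanTensor Φ (chanR u) (chanS u)) x.1 x.2.1 x.2.2) i).re := by
  have h1 := (differentiable_logLikelihood hσ Φ Z u).lineDeriv_eq_fderiv (v := Pi.single i c)
  rw [← h1, lineDeriv]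
  set s := scoreVec σ (jacobian Φ (chanR u) (chanS u))
    (fun x => (Z - meanTensor Φ (chanR u) (chanS u)) x.1 x.2.1 x.2.2) i
  set γ := 1 / σ ^ 2 * ∑ x, ‖jacobian Φ (chanR u) (chanS u) x i‖ ^ 2
  have h2 : ∀ t : ℝ, logLikelihood σ Φ Z (u + t • (Pi.single i c : ParamIdx K M N → ℂ)) =
      logLikelihood σ Φ Z u + t * (2 * (c * s).re) - t ^ 2 * (‖c‖ ^ 2 * γ) := by
    intro t
    rw [← Pi.single_smul, logLikelihood_add_single hσ, norm_smul, mul_pow, Real.norm_eq_abs,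
      sq_abs, Complex.real_smul, mul_assoc, Complex.re_ofReal_mul]
    ring
  simp_rw [h2]
  have h3 : HasDerivAt (fun t : ℝ =>
      logLikelihood σ Φ Z u + t * (2 * (c * s).re) - t ^ 2 * (‖c‖ ^ 2 * γ))
      (1 * (2 * (c * s).re) - (2 : ℕ) * (0 : ℝ) ^ (2 - 1) * (‖c‖ ^ 2 * γ)) 0 :=
    (((hasDerivAt_id (0 : ℝ)).mul_const _).const_add _).sub
      ((hasDerivAt_pow 2 (0 : ℝ)).mul_const _)
  rw [h3.deriv]
  simp

theorem score_eq {σ : ℝ} (hσ : 0 < σ) (Φ : Matrix (Fin P) (Fin N) ℂ)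
    (Z : Tensor K M P) (u : ParamIdx K M N → ℂ) :
    score σ Φ Z u =
      Sum.elim (scoreVec σ (jacobian Φ (chanR u) (chanS u))
        fun x => (Z - meanTensor Φ (chanR u) (chanS u)) x.1 x.2.1 x.2.2)
      (fun i => conj (scoreVec σ (jacobian Φ (chanR u) (chanS u))
        (fun x => (Z - meanTensor Φ (chanR u) (chanS u)) x.1 x.2.1 x.2.2) i)) := by
  funext i
  rcases i with i | i
  · simp only [score, Sum.elim_inl, wirtinger, fderiv_logLikelihood_single hσ, one_mul]
    apply Complex.ext <;> simp
  · simp only [score, Sum.elim_inr, wirtingerConj, fderiv_logLikelihood_single hσ, one_mul]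
    apply Complex.ext
    · simp
    · simp
      ring

theorem score_observation {σ : ℝ} (hσ : 0 < σ) (Φ : Matrix (Fin P) (Fin N) ℂ)
    {X : Matrix (Fin M) (Fin T) ℂ} (hX : X * Xᴴ = 1) (Hr : Matrix (Fin K) (Fin N) ℂ)
    {Hs : Matrix (Fin N) (Fin M) ℂ} (hHs : ∀ n, Hs n 0 = 1)
    (W : Fin P → Matrix (Fin K) (Fin T) ℂ) :
    score σ Φ (observation Φ X Hr Hs W) (paramVec Hr Hs) =
      Sum.elim (scoreVec σ (jacobian Φ Hr Hs) (noiseVec X W))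
        (fun i => conj (scoreVec σ (jacobian Φ Hr Hs) (noiseVec X W) i)) := by
  rw [score_eq hσ, chanR_paramVec, chanS_paramVec Hr hHs, observation_sub_meanTensor Φ hX]

end Score

/-! ### The Fisher information matrix -/

section Fisher

variable {K M N P T : ℕ} {Ω : Type*} [MeasurableSpace Ω] {μ : Measure Ω} {σ : ℝ}
  {X : Matrix (Fin M) (Fin T) ℂ} {W : Ω → Fin P → Matrix (Fin K) (Fin T) ℂ} {J : Type*}

theorem memLp_scoreVec (hWlaw : ∀ p k t, HasLaw (fun ω => W ω p k t) (complexGaussian σ) μ)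
    (A : Matrix (Fin K × Fin M × Fin P) J ℂ) (i : J) :
    MemLp (fun ω => scoreVec σ A (noiseVec X (W ω)) i) 2 μ :=
  (memLp_finsetSum _ fun x _ => (memLp_noiseVec hWlaw x).star.mul_const _).const_mul _

theorem integral_scoreVec [IsProbabilityMeasure μ]
    (hWlaw : ∀ p k t, HasLaw (fun ω => W ω p k t) (complexGaussian σ) μ)
    (A : Matrix (Fin K × Fin M × Fin P) J ℂ) (i : J) :
    ∫ ω, scoreVec σ A (noiseVec X (W ω)) i ∂μ = 0 := by
  have hi : ∀ x, Integrable (fun ω => conj (noiseVec X (W ω) x) * A x i) μ := fun x =>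
    ((memLp_noiseVec hWlaw x).star.integrable one_le_two).mul_const _
  simp only [scoreVec]
  rw [integral_const_mul, integral_finsetSum _ fun x _ => hi x]
  simp [integral_mul_const, integral_conj, integral_noiseVec hWlaw]

theorem integral_conj_scoreVec_mul_scoreVec (hσ : 0 < σ) (hX : X * Xᴴ = 1)
    (hWlaw : ∀ p k t, HasLaw (fun ω => W ω p k t) (complexGaussian σ) μ)
    (hWindep : iIndepFun (fun (i : Fin P × Fin K × Fin T) ω => W ω i.1 i.2.1 i.2.2) μ)
    (A : Matrix (Fin K × Fin M × Fin P) J ℂ) (i j : J) :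
    ∫ ω, conj (scoreVec σ A (noiseVec X (W ω)) i) * scoreVec σ A (noiseVec X (W ω)) j ∂μ =
      1 / (σ : ℂ) ^ 2 * (Aᴴ * A) i j := by
  have hm := fun x => memLp_noiseVec (X := X) hWlaw x
  have hi : ∀ x y, Integrable (fun ω => noiseVec X (W ω) x * conj (noiseVec X (W ω) y) *
      (conj (A x i) * A y j)) μ := fun x y => ((hm x).integrable_mul (hm y).star).mul_const _
  have hexp : ∀ ω, conj (scoreVec σ A (noiseVec X (W ω)) i) *
      scoreVec σ A (noiseVec X (W ω)) j = (1 / (σ : ℂ) ^ 2) ^ 2 *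
      ∑ x, ∑ y, noiseVec X (W ω) x * conj (noiseVec X (W ω) y) * (conj (A x i) * A y j) := by
    intro ω
    simp only [scoreVec, map_mul, map_div₀, map_one, map_pow, Complex.conj_ofReal, map_sum,
      Complex.conj_conj]
    rw [mul_mul_mul_comm, ← sq, Finset.sum_mul_sum]
    congr 1
    exact Finset.sum_congr rfl fun x _ => Finset.sum_congr rfl fun y _ => by ring
  have hσ0 : (σ : ℂ) ≠ 0 := by exact_mod_cast hσ.ne'
  simp_rw [hexp]
  rw [integral_const_mul, integral_finsetSum _ fun x _ => integrable_finsetSum _ fun y _ => hi x y]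
  simp_rw [fun x => integral_finsetSum (μ := μ) Finset.univ fun y _ => hi x y,
    integral_mul_const, integral_noiseVec_mul_conj hX hWlaw hWindep]
  simp only [ite_mul, zero_mul, Finset.sum_ite_eq, Finset.mem_univ, if_true, ← Finset.mul_sum,
    Matrix.mul_apply, Matrix.conjTranspose_apply]
  rw [← mul_assoc]
  congr 1
  field_simp

/-- Circular symmetry: the score is uncorrelated with its conjugate. -/
theorem integral_scoreVec_mul_scoreVec
    (hWlaw : ∀ p k t, HasLaw (fun ω => W ω p k t) (complexGaussian σ) μ)
    (hWindep : iIndepFun (fun (i : Fin P × Fin K × Fin T) ω => W ω i.1 i.2.1 i.2.2) μ)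
    (A : Matrix (Fin K × Fin M × Fin P) J ℂ) (i j : J) :
    ∫ ω, scoreVec σ A (noiseVec X (W ω)) i * scoreVec σ A (noiseVec X (W ω)) j ∂μ = 0 := by
  have hm := fun x => memLp_noiseVec (X := X) hWlaw x
  have hi : ∀ x y, Integrable (fun ω => conj (noiseVec X (W ω) x * noiseVec X (W ω) y) *
      (A x i * A y j)) μ := fun x y => by
    simp only [map_mul]
    exact ((hm x).star.integrable_mul (hm y).star).mul_const _
  have hexp : ∀ ω, scoreVec σ A (noiseVec X (W ω)) i *
      scoreVec σ A (noiseVec X (W ω)) j = (1 / (σ : ℂ) ^ 2) ^ 2 *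
      ∑ x, ∑ y, conj (noiseVec X (W ω) x * noiseVec X (W ω) y) * (A x i * A y j) := by
    intro ω
    simp only [scoreVec]
    rw [mul_mul_mul_comm, ← sq, Finset.sum_mul_sum]
    congr 1
    exact Finset.sum_congr rfl fun x _ => Finset.sum_congr rfl fun y _ => by
      rw [map_mul]
      ring
  simp_rw [hexp]
  rw [integral_const_mul, integral_finsetSum _ fun x _ => integrable_finsetSum _ fun y _ => hi x y]
  simp_rw [fun x => integral_finsetSum (μ := μ) Finset.univ fun y _ => hi x y,
    integral_mul_const, integral_conj, integral_noiseVec_mul hWlaw hWindep]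
  simp

theorem noiseCrossCov_apply (hX : X * Xᴴ = 1)
    (hWlaw : ∀ p k t, HasLaw (fun ω => W ω p k t) (complexGaussian σ) μ)
    (hWindep : iIndepFun (fun (i : Fin P × Fin K × Fin T) ω => W ω i.1 i.2.1 i.2.2) μ)
    (k : Fin K) (m : Fin M) (i : Fin M × Fin P) (j : Fin P × Fin K) :
    noiseCrossCov μ X W k m i j =
      if i.1 = m ∧ i.2 = j.1 ∧ j.2 = k then (σ : ℂ) ^ 2 else 0 := by
  have h := integral_noiseVec_mul_conj hX hWlaw hWindep (k, i.1, i.2) (j.2, m, j.1)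
  refine Eq.trans h ?_
  congr 1
  simp only [Prod.mk.injEq, eq_comm, eq_iff_iff]
  tauto

variable [NeZero M]

/-- `Ψ` is a multiple of the Gram matrix of the Jacobian; the noise cross-covariance in `Ψ₂` picks,
for every `p`, the one pair of rows that the columns of `a_k` and `b_m` share. -/
theorem Psi_eq_jacobian (hσ : 0 < σ) (hX : X * Xᴴ = 1)
    (hWlaw : ∀ p k t, HasLaw (fun ω => W ω p k t) (complexGaussian σ) μ)
    (hWindep : iIndepFun (fun (i : Fin P × Fin K × Fin T) ω => W ω i.1 i.2.1 i.2.2) μ)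
    (Φ : Matrix (Fin P) (Fin N) ℂ) (Hr : Matrix (Fin K) (Fin N) ℂ)
    (Hs : Matrix (Fin N) (Fin M) ℂ) :
    Psi μ σ Φ X W Hr Hs =
      (1 / (σ : ℂ) ^ 2) • ((jacobian Φ Hr Hs)ᴴ * jacobian Φ Hr Hs) := by
  have hσ0 : (σ : ℂ) ≠ 0 := by exact_mod_cast hσ.ne'
  have h11 : ∀ a b, Psi1 σ Φ Hs a b = 1 / (σ : ℂ) ^ 2 *
      ∑ x, conj (jacobian Φ Hr Hs x (Sum.inl a)) * jacobian Φ Hr Hs x (Sum.inl b) := by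
    intro a b
    simp only [Psi1, Matrix.of_apply, jacobian, Sum.elim_inl, Fintype.sum_prod_type,
      Matrix.mul_apply, Matrix.conjTranspose_apply]
    by_cases hab : a.1 = b.1
    · rw [if_pos hab, hab, Finset.sum_eq_single b.1]
      · simp
      · intro k _ hk
        simp [hk]
      · simp
    · rw [if_neg hab]
      symm
      refine mul_eq_zero_of_right _ (Finset.sum_eq_zero fun k _ => ?_)
      by_cases hk : k = a.1
      · simp [hk, hab]
      · simp [hk]
  have h22 : ∀ a b, Psi3 σ Φ Hr a b = 1 / (σ : ℂ) ^ 2 *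
      ∑ x, conj (jacobian Φ Hr Hs x (Sum.inr a)) * jacobian Φ Hr Hs x (Sum.inr b) := by
    intro a b
    simp only [Psi3, Matrix.of_apply, jacobian, Sum.elim_inr, Fintype.sum_prod_type,
      Matrix.mul_apply, Matrix.conjTranspose_apply]
    by_cases hab : a.1 = b.1
    · rw [if_pos hab, hab, Finset.sum_comm (s := (Finset.univ : Finset (Fin P)))]
      congr 1
      refine Finset.sum_congr rfl fun k _ => ?_
      rw [Finset.sum_eq_single b.1.1]
      · simp
      · intro m _ hm
        simp [hm]
      · simp
    · rw [if_neg hab]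
      symm
      refine mul_eq_zero_of_right _ (Finset.sum_eq_zero fun k _ => Finset.sum_eq_zero fun m _ => ?_)
      by_cases hm : m = a.1.1
      · simp [hm, Subtype.ext_iff.not.1 hab]
      · simp [hm]
  have h12 : ∀ a b, Psi2 μ σ Φ X W Hr Hs a b = 1 / (σ : ℂ) ^ 2 *
      ∑ x, conj (jacobian Φ Hr Hs x (Sum.inl a)) * jacobian Φ Hr Hs x (Sum.inr b) := by
    intro a b
    have hl : ∀ y, ((khatriRao Hsᵀ Φ)ᴴ * noiseCrossCov μ X W a.1 b.1.1) a.2 y =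
        if y.2 = a.1 then (σ : ℂ) ^ 2 * conj (khatriRao Hsᵀ Φ (b.1.1, y.1) a.2) else 0 := by
      intro y
      simp only [Matrix.mul_apply, Matrix.conjTranspose_apply,
        noiseCrossCov_apply hX hWlaw hWindep, Fintype.sum_prod_type]
      by_cases hy : y.2 = a.1
      · rw [Finset.sum_eq_single b.1.1, Finset.sum_eq_single y.1]
        · simp [hy, mul_comm]
        · intro p _ hp
          simp [hp]
        · simp
        · intro m _ hm
          simp [hm]
        · simp
      · simp [hy]
    have hr : ∑ x, conj (jacobian Φ Hr Hs x (Sum.inl a)) * jacobian Φ Hr Hs x (Sum.inr b) =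
        ∑ p, conj (khatriRao Hsᵀ Φ (b.1.1, p) a.2) * khatriRao Φ Hr (p, a.1) b.2 := by
      simp only [Fintype.sum_prod_type, jacobian, Matrix.of_apply, Sum.elim_inl, Sum.elim_inr]
      rw [Finset.sum_eq_single a.1, Finset.sum_eq_single b.1.1]
      · simp
      · intro m _ hm
        simp [hm]
      · simp
      · intro k _ hk
        simp [hk]
      · simp
    rw [hr]
    simp only [Psi2, Matrix.of_apply]
    rw [Matrix.mul_apply]
    simp only [hl, Fintype.sum_prod_type, ite_mul, zero_mul, Finset.sum_ite_eq', Finset.mem_univ,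
      if_true, Finset.mul_sum]
    refine Finset.sum_congr rfl fun p _ => ?_
    field_simp
  ext i j
  rw [Matrix.smul_apply, Matrix.mul_apply, smul_eq_mul]
  simp only [Matrix.conjTranspose_apply]
  rcases i with a | a <;> rcases j with b | b
  · exact h11 a b
  · exact h12 a b
  · refine (congrArg conj (h12 b a)).trans ?_
    simp only [map_mul, map_div₀, map_one, map_pow, Complex.conj_ofReal, map_sum,
      Complex.conj_conj]
    congr 1
    exact Finset.sum_congr rfl fun x _ => mul_comm _ _
  · exact h22 a b

theorem fisherInfo_eq (hσ : 0 < σ) (hX : X * Xᴴ = 1)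
    (hWlaw : ∀ p k t, HasLaw (fun ω => W ω p k t) (complexGaussian σ) μ)
    (hWindep : iIndepFun (fun (i : Fin P × Fin K × Fin T) ω => W ω i.1 i.2.1 i.2.2) μ)
    (Φ : Matrix (Fin P) (Fin N) ℂ) (Hr : Matrix (Fin K) (Fin N) ℂ)
    {Hs : Matrix (Fin N) (Fin M) ℂ} (hHs : ∀ n, Hs n 0 = 1) :
    fisherInfo μ σ Φ X W Hr Hs =
      Matrix.fromBlocks (Psi μ σ Φ X W Hr Hs) 0 0 ((Psi μ σ Φ X W Hr Hs).map conj) := by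
  have h1 := integral_conj_scoreVec_mul_scoreVec hσ hX hWlaw hWindep (jacobian Φ Hr Hs)
  have h2 := integral_scoreVec_mul_scoreVec (X := X) hWlaw hWindep (jacobian Φ Hr Hs)
  rw [Psi_eq_jacobian hσ hX hWlaw hWindep]
  ext i j
  simp only [fisherInfo, Matrix.of_apply, score_observation hσ Φ hX Hr hHs]
  rcases i with i | i <;> rcases j with j | j
  · exact h1 i j
  · simp only [Sum.elim_inl, Sum.elim_inr, ← map_mul, integral_conj, h2, map_zero]
    rfl
  · simp only [Sum.elim_inl, Sum.elim_inr, Complex.conj_conj, h2]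
    rfl
  · simp only [Sum.elim_inr, ← map_mul, integral_conj]
    exact congrArg conj (h1 i j)

theorem memLp_score (hσ : 0 < σ) (hX : X * Xᴴ = 1)
    (hWlaw : ∀ p k t, HasLaw (fun ω => W ω p k t) (complexGaussian σ) μ)
    (Φ : Matrix (Fin P) (Fin N) ℂ) (Hr : Matrix (Fin K) (Fin N) ℂ)
    {Hs : Matrix (Fin N) (Fin M) ℂ} (hHs : ∀ n, Hs n 0 = 1)
    (i : ParamIdx K M N ⊕ ParamIdx K M N) :
    MemLp (fun ω => score σ Φ (observation Φ X Hr Hs (W ω)) (paramVec Hr Hs) i) 2 μ := by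
  simp only [score_observation hσ Φ hX Hr hHs]
  rcases i with i | i
  · exact memLp_scoreVec hWlaw _ i
  · exact (memLp_scoreVec hWlaw _ i).star

end Fisher

/-! ### Block inverses -/

theorem inv_map_conj {n : Type*} [Fintype n] [DecidableEq n] (A : Matrix n n ℂ) :
    (A.map conj)⁻¹ = A⁻¹.map conj := by
  have h : ∀ B : Matrix n n ℂ, B.map conj = Bᴴᵀ := fun B => by
    ext i j
    simp
  rw [h, h, ← Matrix.transpose_nonsing_inv, Matrix.conjTranspose_nonsing_inv]

theorem isUnit_det_and_inv_fromBlocks_map_conj {n : Type*} [Fintype n] [DecidableEq n]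
    {A : Matrix n n ℂ} (h : IsUnit (Matrix.fromBlocks A 0 0 (A.map conj)).det) :
    IsUnit A.det ∧ (Matrix.fromBlocks A 0 0 (A.map conj))⁻¹ =
      Matrix.fromBlocks A⁻¹ 0 0 (A⁻¹.map conj) := by
  rw [Matrix.det_fromBlocks_zero₂₁, IsUnit.mul_iff] at h
  refine ⟨h.1, ?_⟩
  rw [Matrix.inv_fromBlocks_zero₂₁_of_isUnit_iff, inv_map_conj]
  · simp
  · simp only [Matrix.isUnit_iff_isUnit_det, h.1, h.2]

section Schur

variable {m n : Type*} [Fintype m] [Fintype n] [DecidableEq m] [DecidableEq n]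

/-- If a block matrix and its lower right block are invertible, so is the Schur complement of that
block, and its inverse is the upper left block of the inverse matrix. -/
theorem schur_fromBlocks₂₂ {A : Matrix m m ℂ} {B : Matrix m n ℂ} {C : Matrix n m ℂ}
    {D : Matrix n n ℂ} (h : IsUnit (Matrix.fromBlocks A B C D)) (hD : IsUnit D) :
    IsUnit (A - B * D⁻¹ * C).det ∧
      (Matrix.fromBlocks A B C D)⁻¹.toBlocks₁₁ = (A - B * D⁻¹ * C)⁻¹ := by
  let _ := hD.invertible
  have hS := Matrix.isUnit_fromBlocks_iff_of_invertible₂₂.1 h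
  let _ := hS.invertible
  let _ := h.invertible
  refine ⟨?_, ?_⟩
  · rw [← Matrix.invOf_eq_nonsing_inv]
    exact (Matrix.isUnit_iff_isUnit_det _).1 hS
  · rw [← Matrix.invOf_eq_nonsing_inv, Matrix.invOf_fromBlocks₂₂_eq,
      Matrix.toBlocks_fromBlocks₁₁, Matrix.invOf_eq_nonsing_inv, Matrix.invOf_eq_nonsing_inv]

/-- The mirror image of `schur_fromBlocks₂₂`, with the roles of the diagonal blocks exchanged. -/
theorem schur_fromBlocks₁₁ {A : Matrix m m ℂ} {B : Matrix m n ℂ} {C : Matrix n m ℂ}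
    {D : Matrix n n ℂ} (h : IsUnit (Matrix.fromBlocks A B C D)) (hA : IsUnit A) :
    IsUnit (D - C * A⁻¹ * B).det ∧
      (Matrix.fromBlocks A B C D)⁻¹.toBlocks₂₂ = (D - C * A⁻¹ * B)⁻¹ := by
  let _ := hA.invertible
  have hS := Matrix.isUnit_fromBlocks_iff_of_invertible₁₁.1 h
  let _ := hS.invertible
  let _ := h.invertible
  refine ⟨?_, ?_⟩
  · rw [← Matrix.invOf_eq_nonsing_inv]
    exact (Matrix.isUnit_iff_isUnit_det _).1 hS
  · rw [← Matrix.invOf_eq_nonsing_inv, Matrix.invOf_fromBlocks₁₁_eq,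
      Matrix.toBlocks_fromBlocks₂₂, Matrix.invOf_eq_nonsing_inv, Matrix.invOf_eq_nonsing_inv]

end Schur

/-! ### The covariance inequality -/

section Covariance

variable {Ω : Type*} [MeasurableSpace Ω] {μ : Measure Ω}

/-- The second-moment matrix of square-integrable variables is positive semidefinite: its quadratic
form at `x` is `E[‖∑ a, conj (x a) * h a‖ ^ 2]`. -/
theorem posSemidef_gram {κ : Type*} [Fintype κ] {h : κ → Ω → ℂ} (hm : ∀ a, MemLp (h a) 2 μ) :
    (Matrix.of fun a b => ∫ ω, h a ω * conj (h b ω) ∂μ).PosSemidef := by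
  have hi : ∀ a b, Integrable (fun ω => h a ω * conj (h b ω)) μ := fun a b =>
    (hm a).integrable_mul (hm b).star
  refine Matrix.PosSemidef.of_dotProduct_mulVec_nonneg ?_ fun x => ?_
  · ext a b
    simp only [Matrix.conjTranspose_apply, Matrix.of_apply, RCLike.star_def, ← integral_conj,
      map_mul, Complex.conj_conj]
    exact integral_congr_ae (ae_of_all _ fun ω => mul_comm _ _)
  · have hq : star x ⬝ᵥ (Matrix.of fun a b => ∫ ω, h a ω * conj (h b ω) ∂μ) *ᵥ x =
        ∫ ω, ((‖∑ a, conj (x a) * h a ω‖ ^ 2 : ℝ) : ℂ) ∂μ := by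
      have hexp : ∀ ω, ((‖∑ a, conj (x a) * h a ω‖ ^ 2 : ℝ) : ℂ) =
          ∑ a, ∑ b, conj (x a) * (h a ω * conj (h b ω) * x b) := by
        intro ω
        rw [Complex.ofReal_pow, ← Complex.mul_conj', map_sum, Finset.sum_mul_sum]
        refine Finset.sum_congr rfl fun a _ => Finset.sum_congr rfl fun b _ => ?_
        rw [map_mul, Complex.conj_conj]
        ring
      have hi' : ∀ a b, Integrable (fun ω => conj (x a) * (h a ω * conj (h b ω) * x b)) μ :=
        fun a b => ((hi a b).mul_const _).const_mul _
      simp_rw [hexp]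
      rw [integral_finsetSum _ fun a _ => integrable_finsetSum _ fun b _ => hi' a b]
      simp_rw [fun a => integral_finsetSum (μ := μ) Finset.univ fun b _ => hi' a b,
        integral_const_mul, integral_mul_const, ← Finset.mul_sum]
      rfl
    rw [hq, integral_complex_ofReal]
    exact_mod_cast integral_nonneg fun ω => by positivity

/-- The covariance inequality behind the Cramér-Rao bound: the Gram matrix of `g` and `conj s` is
positive semidefinite, and so is the Schur complement of its block `F = E[(conj s) (conj s)ᴴ]`. -/
theorem posSemidef_gram_sub_submatrix_inv {ι J : Type*} [Fintype ι] [Fintype J] [DecidableEq J]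
    {g : ι → Ω → ℂ} {s : J → Ω → ℂ} (hg : ∀ a, MemLp (g a) 2 μ) (hs : ∀ j, MemLp (s j) 2 μ)
    {F : Matrix J J ℂ} (hF : F.PosDef)
    (hFs : ∀ i j, ∫ ω, conj (s i ω) * s j ω ∂μ = F i j) (e : ι → J)
    (hgs : ∀ a j, ∫ ω, g a ω * s j ω ∂μ = if e a = j then 1 else 0) :
    ((Matrix.of fun a b => ∫ ω, g a ω * conj (g b ω) ∂μ) - F⁻¹.submatrix e e).PosSemidef := by
  classical
  let D : Matrix ι J ℂ := Matrix.of fun a j => if e a = j then 1 else 0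
  let _ := hF.isUnit.invertible
  have hgram := posSemidef_gram (μ := μ) (κ := ι ⊕ J)
    (h := Sum.elim g fun j ω => conj (s j ω)) (by
      rintro (a | j)
      · exact hg a
      · exact (hs j).star)
  have hblocks : (Matrix.of fun a b => ∫ ω, Sum.elim g (fun j ω => conj (s j ω)) a ω *
        conj (Sum.elim g (fun j ω => conj (s j ω)) b ω) ∂μ) =
      Matrix.fromBlocks (Matrix.of fun a b => ∫ ω, g a ω * conj (g b ω) ∂μ) D Dᴴ F := by
    ext a b
    rcases a with a | i <;> rcases b with b | j
    · rfl
    · simp [D, hgs]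
    · have h := congrArg conj (hgs b i)
      simp only [Matrix.of_apply, Sum.elim_inl, Sum.elim_inr, Matrix.fromBlocks_apply₂₁, D,
        Matrix.conjTranspose_apply, RCLike.star_def]
      rw [← h, ← integral_conj]
      exact integral_congr_ae (ae_of_all _ fun ω => by simp [mul_comm])
    · simp [hFs]
  rw [hblocks, Matrix.PosDef.fromBlocks₂₂ _ _ hF] at hgram
  have hD : D * F⁻¹ * Dᴴ = F⁻¹.submatrix e e := by
    ext a b
    simp [Matrix.mul_apply, D, Matrix.conjTranspose_apply, apply_ite]
  rwa [hD] at hgram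

end Covariance

/-! ### Differentiation of the mean of an estimator -/

section Differentiation

variable {Ω : Type*} [MeasurableSpace Ω] {μ : Measure Ω} {ξ : Ω → ℝ} {v : NNReal}

theorem memLp_exp_mul_of_hasLaw_gaussianReal (hξ : HasLaw ξ (gaussianReal 0 v) μ) (a : ℝ) :
    MemLp (fun ω => Real.exp (a * ξ ω)) 2 μ := by
  have hmeas : AEStronglyMeasurable (fun ω => Real.exp (a * ξ ω)) μ :=
    (Real.measurable_exp.comp_aemeasurable (hξ.aemeasurable.const_mul a)).aestronglyMeasurable
  rw [memLp_two_iff_integrable_sq hmeas]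
  have h := integrable_exp_mul_gaussianReal (μ := 0) (v := v) (2 * a)
  rw [← hξ.map_eq, integrable_map_measure (by fun_prop) hξ.aemeasurable] at h
  refine h.congr (ae_of_all _ fun ω => ?_)
  simp only [Function.comp_apply, ← Real.exp_nat_mul]
  congr 1
  push_cast
  ring

/-- An exponential tilt by a Gaussian variable may be differentiated under the integral sign
against every square-integrable function. -/
theorem hasDerivAt_integral_mul_exp {g : Ω → ℂ} (hg : MemLp g 2 μ)
    (hξ : HasLaw ξ (gaussianReal 0 v) μ) (γ : ℝ) :
    HasDerivAt (fun t : ℝ => ∫ ω, g ω * (Real.exp (t * ξ ω - t ^ 2 * γ) : ℝ) ∂μ)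
      (∫ ω, g ω * ξ ω ∂μ) 0 := by
  have : IsProbabilityMeasure μ := hξ.isProbabilityMeasure
  let C : ℝ := (1 + 2 * |γ|) * Real.exp |γ|
  let bound : Ω → ℝ := fun ω => ‖g ω‖ * (C * (Real.exp (2 * ξ ω) + Real.exp (-2 * ξ ω)))
  let F' : ℝ → Ω → ℂ := fun t ω =>
    g ω * (((ξ ω - 2 * t * γ) * Real.exp (t * ξ ω - t ^ 2 * γ) : ℝ) : ℂ)
  have hξm := hξ.aemeasurable
  have hmeas : ∀ f : ℝ → ℝ, Continuous f →
      AEStronglyMeasurable (fun ω => g ω * (f (ξ ω) : ℂ)) μ := fun f hf =>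
    hg.aestronglyMeasurable.mul (Complex.measurable_ofReal.comp_aemeasurable
      (hf.measurable.comp_aemeasurable hξm)).aestronglyMeasurable
  -- for `|t| ≤ 1` the factor next to `g` is dominated by a multiple of `exp (2 |ξ|)`, which is at
  -- most `exp (2 ξ) + exp (-2 ξ)` and thus square integrable
  have hbound : Integrable bound μ :=
    hg.norm.integrable_mul (((memLp_exp_mul_of_hasLaw_gaussianReal hξ 2).add
      (memLp_exp_mul_of_hasLaw_gaussianReal hξ (-2))).const_mul C)
  have hle : ∀ ω, ∀ t ∈ Metric.ball (0 : ℝ) 1, ‖F' t ω‖ ≤ bound ω := by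
    intro ω t ht
    have ht1 : |t| ≤ 1 := by
      rw [mem_ball_zero_iff, Real.norm_eq_abs] at ht
      exact ht.le
    have ht2 : t ^ 2 ≤ 1 := by
      rw [← sq_abs]
      exact pow_le_one₀ (abs_nonneg t) ht1
    have e1 : |ξ ω - 2 * t * γ| ≤ (1 + 2 * |γ|) * Real.exp |ξ ω| := by
      have h1 : |ξ ω| ≤ Real.exp |ξ ω| := by linarith [Real.add_one_le_exp |ξ ω|]
      have h2 : 1 ≤ Real.exp |ξ ω| := Real.one_le_exp (abs_nonneg _)
      have h3 : |2 * t * γ| ≤ 2 * |γ| := by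
        rw [abs_mul, abs_mul, abs_two]
        nlinarith [abs_nonneg γ]
      have h4 : 2 * |γ| * 1 ≤ 2 * |γ| * Real.exp |ξ ω| := by gcongr
      have h5 := abs_sub (ξ ω) (2 * t * γ)
      nlinarith
    have e2 : Real.exp (t * ξ ω - t ^ 2 * γ) ≤ Real.exp |γ| * Real.exp |ξ ω| := by
      rw [← Real.exp_add]
      apply Real.exp_le_exp.2
      have h1 : t * ξ ω ≤ |ξ ω| := by
        refine (le_abs_self _).trans ?_
        rw [abs_mul]
        exact mul_le_of_le_one_left (abs_nonneg _) ht1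
      have h2 : -(t ^ 2 * γ) ≤ |γ| := by
        refine (neg_le_abs _).trans ?_
        rw [abs_mul, abs_of_nonneg (sq_nonneg t)]
        exact mul_le_of_le_one_left (abs_nonneg _) ht2
      linarith
    have e3 : Real.exp |ξ ω| * Real.exp |ξ ω| ≤ Real.exp (2 * ξ ω) + Real.exp (-2 * ξ ω) := by
      rw [← Real.exp_add]
      rcases abs_cases (ξ ω) with h | h
      · rw [h.1, ← two_mul]
        exact le_add_of_nonneg_right (Real.exp_pos _).le
      · rw [h.1, ← two_mul, mul_neg, ← neg_mul]
        exact le_add_of_nonneg_left (Real.exp_pos _).le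
    simp only [F', bound, norm_mul, Complex.norm_real, Real.norm_eq_abs, Real.abs_exp]
    refine mul_le_mul_of_nonneg_left ?_ (norm_nonneg _)
    calc |ξ ω - 2 * t * γ| * Real.exp (t * ξ ω - t ^ 2 * γ)
        ≤ ((1 + 2 * |γ|) * Real.exp |ξ ω|) * (Real.exp |γ| * Real.exp |ξ ω|) := by gcongr
      _ = C * (Real.exp |ξ ω| * Real.exp |ξ ω|) := by
          simp only [C]
          ring
      _ ≤ _ := by gcongr
  have hderiv : ∀ ω, ∀ t ∈ Metric.ball (0 : ℝ) 1, HasDerivAt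
      (fun t : ℝ => g ω * ((Real.exp (t * ξ ω - t ^ 2 * γ) : ℝ) : ℂ)) (F' t ω) t := by
    intro ω t _
    have h1 : HasDerivAt (fun t : ℝ => t * ξ ω - t ^ 2 * γ) (ξ ω - 2 * t * γ) t := by
      refine (((hasDerivAt_id t).mul_const (ξ ω)).sub
        ((hasDerivAt_pow 2 t).mul_const γ)).congr_deriv ?_
      simp
    have h2 := h1.exp.ofReal_comp.const_mul (g ω)
    refine h2.congr_deriv ?_
    simp only [F']
    push_cast
    ring
  have hmain := hasDerivAt_integral_of_dominated_loc_of_deriv_le (μ := μ) (bound := bound)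
    (F := fun (t : ℝ) ω => g ω * ((Real.exp (t * ξ ω - t ^ 2 * γ) : ℝ) : ℂ)) (F' := F')
    (Metric.ball_mem_nhds (0 : ℝ) one_pos)
    (Filter.Eventually.of_forall fun t => hmeas (fun x => Real.exp (t * x - t ^ 2 * γ))
      (by fun_prop))
    (by simpa using hg.integrable one_le_two)
    (hmeas (fun x => (x - 2 * 0 * γ) * Real.exp (0 * x - 0 ^ 2 * γ)) (by fun_prop))
    (ae_of_all _ hle) hbound (ae_of_all _ hderiv)
  simpa [F'] using hmain.2

end Differentiation

/-! ### The Cramér-Rao bound -/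

section CramerRao

variable {K M N P T : ℕ} {Ω : Type*} [MeasurableSpace Ω] {μ : Measure Ω} {σ : ℝ}
  {X : Matrix (Fin M) (Fin T) ℂ} {W : Ω → Fin P → Matrix (Fin K) (Fin T) ℂ}

/-- The derivative `2 Re (c s_i)` of the log-likelihood in the direction `c` of the `i`-th
coordinate is a centred real Gaussian variable. -/
theorem hasLaw_re_mul_scoreVec [IsProbabilityMeasure μ] (hX : X * Xᴴ = 1)
    (hWlaw : ∀ p k t, HasLaw (fun ω => W ω p k t) (complexGaussian σ) μ)
    (hWindep : iIndepFun (fun (i : Fin P × Fin K × Fin T) ω => W ω i.1 i.2.1 i.2.2) μ)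
    {J : Type*} (A : Matrix (Fin K × Fin M × Fin P) J ℂ) (i : J) (c : ℂ) :
    ∃ v, HasLaw (fun ω => 2 * (c * scoreVec σ A (noiseVec X (W ω)) i).re) (gaussianReal 0 v) μ := by
  let d : Tensor K M P := fun k m p => conj (2 * (c * (1 / (σ : ℂ) ^ 2 * A (k, m, p) i)))
  have hd : ∀ (t : ℝ) ω, t * (2 * (c * scoreVec σ A (noiseVec X (W ω)) i).re) =
      (∑ k, ∑ m, ∑ p, (t * d k m p) * filteredNoise X (W ω) k m p).re := by
    intro t ω
    have hz : ∀ z : ℂ, t * (2 * z.re) = (t * (2 * z)).re := fun z => by simp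
    rw [← Complex.conj_re (∑ k, _), hz]
    congr 1
    simp only [scoreVec, noiseVec, Fintype.sum_prod_type, Finset.mul_sum, map_sum, d, map_mul,
      Complex.conj_conj, Complex.conj_ofReal]
    refine Finset.sum_congr rfl fun k _ => Finset.sum_congr rfl fun m _ =>
      Finset.sum_congr rfl fun p _ => ?_
    ring
  let S : ℝ := σ ^ 2 / 2 * ∑ k, ∑ m, ∑ p, ‖d k m p‖ ^ 2
  have hS : 0 ≤ S := by positivity
  have hmeas : AEMeasurable (fun ω => 2 * (c * scoreVec σ A (noiseVec X (W ω)) i).re) μ := by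
    have h1 := (memLp_scoreVec (X := X) hWlaw A i).aestronglyMeasurable.aemeasurable
    exact (Complex.measurable_re.comp_aemeasurable (h1.const_mul c)).const_mul 2
  refine ⟨S.toNNReal, hmeas, ?_⟩
  have := Measure.isProbabilityMeasure_map hmeas
  refine Measure.ext_of_charFun (funext fun t => ?_)
  rw [charFun_apply_real, integral_map hmeas (by fun_prop), charFun_gaussianReal]
  simp_rw [← Complex.ofReal_mul, hd]
  rw [integral_exp_re_sum_filteredNoise hX hWlaw hWindep (fun k m p => t * d k m p)]
  have hv : ((S.toNNReal : NNReal) : ℂ) = (S : ℂ) :=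
    congrArg (fun r : ℝ => (r : ℂ)) (Real.coe_toNNReal S hS)
  rw [hv]
  simp_rw [norm_mul, mul_pow, ← Finset.mul_sum, Complex.norm_real, Real.norm_eq_abs, sq_abs]
  congr 1
  simp only [S]
  push_cast
  ring

variable [NeZero M]

/-- Change of measure: moving one parameter by `c` multiplies the density of the observation by an
exponential tilt. -/
theorem integral_observation_add_single [IsProbabilityMeasure μ] (hσ : 0 < σ) (hX : X * Xᴴ = 1)
    (hWlaw : ∀ p k t, HasLaw (fun ω => W ω p k t) (complexGaussian σ) μ)
    (hWindep : iIndepFun (fun (i : Fin P × Fin K × Fin T) ω => W ω i.1 i.2.1 i.2.2) μ)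
    (Φ : Matrix (Fin P) (Fin N) ℂ) {g : Tensor K M P → ℂ} (hg : Measurable g)
    (u : ParamIdx K M N → ℂ) (i : ParamIdx K M N) (c : ℂ) :
    ∫ ω, g (observation Φ X (chanR (u + Pi.single i c)) (chanS (u + Pi.single i c)) (W ω)) ∂μ =
      ∫ ω, g (observation Φ X (chanR u) (chanS u) (W ω)) *
        (Real.exp (2 * (c * scoreVec σ (jacobian Φ (chanR u) (chanS u)) (noiseVec X (W ω)) i).re -
          ‖c‖ ^ 2 * (1 / σ ^ 2 * ∑ x, ‖jacobian Φ (chanR u) (chanS u) x i‖ ^ 2)) : ℝ) ∂μ := by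
  set γ := ‖c‖ ^ 2 * (1 / σ ^ 2 * ∑ x, ‖jacobian Φ (chanR u) (chanS u) x i‖ ^ 2)
  let res : Tensor K M P → Fin K × Fin M × Fin P → ℂ := fun Z x =>
    (Z - meanTensor Φ (chanR u) (chanS u)) x.1 x.2.1 x.2.2
  let tilt : Tensor K M P → ℝ := fun Z =>
    Real.exp (2 * (c * scoreVec σ (jacobian Φ (chanR u) (chanS u)) (res Z) i).re - γ)
  have htilt : Measurable tilt := by
    simp only [tilt, scoreVec, res, Pi.sub_apply]
    fun_prop
  have hlik : ∀ Z, likelihood σ Φ (chanR (u + Pi.single i c)) (chanS (u + Pi.single i c)) Z =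
      likelihood σ Φ (chanR u) (chanS u) Z * tilt Z := by
    intro Z
    have h := logLikelihood_add_single hσ Φ Z u i c
    rw [add_sub_assoc] at h
    rw [logLikelihood, logLikelihood] at h
    rw [← Real.exp_log (likelihood_pos hσ Φ (chanR (u + _)) _ Z), h, Real.exp_add,
      Real.exp_log (likelihood_pos hσ Φ _ _ Z)]
  have hlaw : ∀ (w : ParamIdx K M N → ℂ) (f : Tensor K M P → ℂ), Measurable f →
      ∫ ω, f (observation Φ X (chanR w) (chanS w) (W ω)) ∂μ =
        ∫ Z, likelihood σ Φ (chanR w) (chanS w) Z • f Z := by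
    intro w f hf
    have hmap := map_observation_eq_withDensity hσ hX hWlaw hWindep Φ (chanR w) (chanS w)
    have hobs : AEMeasurable (fun ω => observation Φ X (chanR w) (chanS w) (W ω)) μ := by
      simp_rw [observation_eq_meanTensor_add Φ hX]
      exact (aemeasurable_filteredNoise hWlaw).const_add _
    rw [← integral_map hobs hf.aestronglyMeasurable, hmap,
      integral_withDensity_eq_integral_toReal_smul
        (measurable_likelihood σ Φ _ _).ennreal_ofReal (ae_of_all _ fun Z => ENNReal.ofReal_lt_top)]
    simp_rw [ENNReal.toReal_ofReal (likelihood_pos hσ Φ (chanR w) (chanS w) _).le]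
  have hres : ∀ ω, res (observation Φ X (chanR u) (chanS u) (W ω)) = noiseVec X (W ω) :=
    fun ω => observation_sub_meanTensor Φ hX _ _ (W ω)
  have hright := hlaw u (fun Z => g Z * (tilt Z : ℂ)) (by fun_prop)
  simp only [tilt, hres] at hright
  rw [hlaw _ g hg, hright]
  refine integral_congr_ae (ae_of_all _ fun Z => ?_)
  simp only [hlik, Complex.real_smul, tilt]
  push_cast
  ring

/-- Unbiasedness to first order fixes the covariances of an estimator with the score. -/
theorem IsLocallyUnbiased.integral_mul_scoreVec [IsProbabilityMeasure μ] (hσ : 0 < σ)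
    (hX : X * Xᴴ = 1)
    (hWlaw : ∀ p k t, HasLaw (fun ω => W ω p k t) (complexGaussian σ) μ)
    (hWindep : iIndepFun (fun (i : Fin P × Fin K × Fin T) ω => W ω i.1 i.2.1 i.2.2) μ)
    {Φ : Matrix (Fin P) (Fin N) ℂ} {Hr : Matrix (Fin K) (Fin N) ℂ}
    {Hs : Matrix (Fin N) (Fin M) ℂ} (hHs : ∀ n, Hs n 0 = 1) {ι : Type*}
    {e : ι → ParamIdx K M N} {est : Tensor K M P → ι → ℂ}
    (hest : IsLocallyUnbiased μ Φ X W Hr Hs e est) (a : ι) (i : ParamIdx K M N) :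
    ∫ ω, est (observation Φ X Hr Hs (W ω)) a *
      scoreVec σ (jacobian Φ Hr Hs) (noiseVec X (W ω)) i ∂μ = if e a = i then 1 else 0 := by
  set u := paramVec Hr Hs with hu
  set A := jacobian Φ Hr Hs with hA
  let g : Ω → ℂ := fun ω => est (observation Φ X Hr Hs (W ω)) a
  let ξ : ℂ → Ω → ℝ := fun c ω => 2 * (c * scoreVec σ A (noiseVec X (W ω)) i).re
  have hg : MemLp g 2 μ := hest.memLp a
  have hscore := memLp_scoreVec (X := X) hWlaw A i
  -- both sides are the derivative of the mean in the direction `c` of the `i`-th coordinate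
  have key : ∀ c : ℂ, ∫ ω, g ω * ξ c ω ∂μ = (Pi.single i c : ParamIdx K M N → ℂ) (e a) := by
    intro c
    obtain ⟨v, hv⟩ := hasLaw_re_mul_scoreVec hX hWlaw hWindep A i c
    have h1 := hasDerivAt_integral_mul_exp hg hv
      (‖c‖ ^ 2 * (1 / σ ^ 2 * ∑ x, ‖A x i‖ ^ 2))
    have h2 := (hest.deriv_mean_eq a).hasLineDerivAt (Pi.single i c)
    have h3 : ∀ t : ℝ, ∫ ω, est (observation Φ X
        (chanR (u + t • (Pi.single i c : ParamIdx K M N → ℂ)))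
        (chanS (u + t • (Pi.single i c : ParamIdx K M N → ℂ))) (W ω)) a ∂μ =
        ∫ ω, g ω * (Real.exp (t * ξ c ω -
          t ^ 2 * (‖c‖ ^ 2 * (1 / σ ^ 2 * ∑ x, ‖A x i‖ ^ 2))) : ℝ) ∂μ := by
      intro t
      have h := integral_observation_add_single hσ hX hWlaw hWindep Φ (hest.measurable a) u i
        (t • c)
      rw [Pi.single_smul] at h
      rw [h, hu, chanR_paramVec, chanS_paramVec Hr hHs]
      refine integral_congr_ae (ae_of_all _ fun ω => ?_)
      simp only [g, ξ, ← hA, Complex.real_smul, norm_mul, Complex.norm_real, mul_pow,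
        Real.norm_eq_abs, sq_abs, mul_assoc, Complex.re_ofReal_mul]
      congr 4
      ring
    have h4 := (h1.congr_of_eventuallyEq (Filter.Eventually.of_forall h3)).unique h2
    exact h4
  have hint : ∀ c, Integrable (fun ω => g ω * (ξ c ω : ℂ)) μ := fun c =>
    hg.integrable_mul (((hscore.const_mul c).re.const_mul 2).ofReal)
  -- `s = ξ₁ / 2 - 𝐢 ξ_𝐢 / 2`, because `ξ₁ = 2 Re s` and `ξ_𝐢 = -2 Im s`
  have hsplit : ∀ ω, g ω * scoreVec σ A (noiseVec X (W ω)) i =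
      1 / 2 * (g ω * (ξ 1 ω : ℂ)) - Complex.I / 2 * (g ω * (ξ Complex.I ω : ℂ)) := by
    intro ω
    have hz : ∀ z : ℂ, z = 1 / 2 * ((2 * (1 * z).re : ℝ) : ℂ) -
        Complex.I / 2 * ((2 * (Complex.I * z).re : ℝ) : ℂ) := by
      intro z
      apply Complex.ext <;> simp
    conv_lhs => rw [hz (scoreVec σ A (noiseVec X (W ω)) i)]
    simp only [ξ]
    ring
  change ∫ ω, g ω * scoreVec σ A (noiseVec X (W ω)) i ∂μ = _
  simp_rw [hsplit]
  rw [integral_sub ((hint 1).const_mul _) ((hint Complex.I).const_mul _), integral_const_mul,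
    integral_const_mul, key, key]
  by_cases h : e a = i
  · rw [h, Pi.single_eq_same, Pi.single_eq_same, if_pos rfl]
    linear_combination (-1 / 2) * Complex.I_mul_I
  · rw [Pi.single_eq_of_ne h, Pi.single_eq_of_ne h, if_neg h]
    simp

/-- The Cramér-Rao bound for the parameters selected by `e`. -/
theorem IsLocallyUnbiased.posSemidef_errorCov_sub [IsProbabilityMeasure μ] (hσ : 0 < σ)
    (hX : X * Xᴴ = 1)
    (hWlaw : ∀ p k t, HasLaw (fun ω => W ω p k t) (complexGaussian σ) μ)
    (hWindep : iIndepFun (fun (i : Fin P × Fin K × Fin T) ω => W ω i.1 i.2.1 i.2.2) μ)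
    {Φ : Matrix (Fin P) (Fin N) ℂ} {Hr : Matrix (Fin K) (Fin N) ℂ}
    {Hs : Matrix (Fin N) (Fin M) ℂ} (hHs : ∀ n, Hs n 0 = 1) {ι : Type*} [Fintype ι]
    {e : ι → ParamIdx K M N} {est : Tensor K M P → ι → ℂ}
    (hest : IsLocallyUnbiased μ Φ X W Hr Hs e est) (hΨ : (Psi μ σ Φ X W Hr Hs).PosDef) :
    (errorCov μ Φ X W Hr Hs e est - (Psi μ σ Φ X W Hr Hs)⁻¹.submatrix e e).PosSemidef := by
  have hscore := memLp_scoreVec (X := X) hWlaw (jacobian Φ Hr Hs)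
  refine posSemidef_gram_sub_submatrix_inv
    (g := fun a ω => est (observation Φ X Hr Hs (W ω)) a - paramVec Hr Hs (e a))
    (s := fun i ω => scoreVec σ (jacobian Φ Hr Hs) (noiseVec X (W ω)) i)
    (fun a => (hest.memLp a).sub (memLp_const _)) hscore hΨ (fun i j => ?_) e fun a i => ?_
  · rw [integral_conj_scoreVec_mul_scoreVec hσ hX hWlaw hWindep,
      Psi_eq_jacobian hσ hX hWlaw hWindep]
    rfl
  · have h1 : Integrable (fun ω => est (observation Φ X Hr Hs (W ω)) a *
        scoreVec σ (jacobian Φ Hr Hs) (noiseVec X (W ω)) i) μ :=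
      (hest.memLp a).integrable_mul (hscore i)
    simp_rw [sub_mul]
    rw [integral_sub h1 (((hscore i).integrable one_le_two).const_mul _), integral_const_mul,
      integral_scoreVec hWlaw, mul_zero, sub_zero]
    exact hest.integral_mul_scoreVec hσ hX hWlaw hWindep hHs a i

theorem posDef_Psi_of_isUnit (hσ : 0 < σ) (hX : X * Xᴴ = 1)
    (hWlaw : ∀ p k t, HasLaw (fun ω => W ω p k t) (complexGaussian σ) μ)
    (hWindep : iIndepFun (fun (i : Fin P × Fin K × Fin T) ω => W ω i.1 i.2.1 i.2.2) μ)
    {Φ : Matrix (Fin P) (Fin N) ℂ} {Hr : Matrix (Fin K) (Fin N) ℂ}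
    {Hs : Matrix (Fin N) (Fin M) ℂ} (h : IsUnit (Psi μ σ Φ X W Hr Hs).det) :
    (Psi μ σ Φ X W Hr Hs).PosDef := by
  have hps : (Psi μ σ Φ X W Hr Hs).PosSemidef := by
    rw [Psi_eq_jacobian hσ hX hWlaw hWindep]
    refine (Matrix.posSemidef_conjTranspose_mul_self _).smul ?_
    have : (1 / (σ : ℂ) ^ 2) = ((1 / σ ^ 2 : ℝ) : ℂ) := by push_cast; rfl
    rw [this]
    exact_mod_cast (by positivity : (0 : ℝ) ≤ 1 / σ ^ 2)
  exact hps.posDef_iff_isUnit.2 ((Matrix.isUnit_iff_isUnit_det _).2 h)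

end CramerRao

end RISChannel

theorem mainTheorem2 {Ω : Type*} [MeasurableSpace Ω] (μ : Measure Ω) [IsProbabilityMeasure μ]
    (K M N P T : ℕ) [NeZero M] (σ : ℝ) (hσ : 0 < σ)
    (Φ : Matrix (Fin P) (Fin N) ℂ)
    (X : Matrix (Fin M) (Fin T) ℂ) (hX : X * Xᴴ = 1)
    (W : Ω → Fin P → Matrix (Fin K) (Fin T) ℂ)
    (hWlaw : ∀ p k t, HasLaw (fun ω => W ω p k t) (RISChannel.complexGaussian σ) μ)
    (hWindep : iIndepFun (fun (i : Fin P × Fin K × Fin T) ω => W ω i.1 i.2.1 i.2.2) μ)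
    (Hr : Matrix (Fin K) (Fin N) ℂ) (Hs : Matrix (Fin N) (Fin M) ℂ) (hHs : ∀ n, Hs n 0 = 1) :
    -- `likelihood` is the density of the observation
    μ.map (fun ω => RISChannel.observation Φ X Hr Hs (W ω)) =
        (volume : Measure (RISChannel.Tensor K M P)).withDensity
          (fun Z => ENNReal.ofReal (RISChannel.likelihood σ Φ Hr Hs Z)) ∧
    -- the score is square integrable, and the Fisher information matrix is block-diagonal
    (∀ i, MemLp (fun ω => RISChannel.score σ Φ (RISChannel.observation Φ X Hr Hs (W ω))
        (RISChannel.paramVec Hr Hs) i) 2 μ) ∧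
    RISChannel.fisherInfo μ σ Φ X W Hr Hs =
      Matrix.fromBlocks (RISChannel.Psi μ σ Φ X W Hr Hs) 0 0
        ((RISChannel.Psi μ σ Φ X W Hr Hs).map conj) ∧
    -- the noise cross-covariance
    (∀ (k : Fin K) (m : Fin M) (i : Fin M × Fin P) (j : Fin P × Fin K),
      RISChannel.noiseCrossCov μ X W k m i j =
        if i.1 = m ∧ i.2 = j.1 ∧ j.2 = k then (σ : ℂ) ^ 2 else 0) ∧
    -- the Cramér-Rao bounds, whenever the Fisher information matrix is nonsingular
    (IsUnit (RISChannel.fisherInfo μ σ Φ X W Hr Hs).det →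
      IsUnit (RISChannel.Psi μ σ Φ X W Hr Hs).det ∧
      (RISChannel.fisherInfo μ σ Φ X W Hr Hs)⁻¹ =
        Matrix.fromBlocks (RISChannel.Psi μ σ Φ X W Hr Hs)⁻¹ 0 0
          ((RISChannel.Psi μ σ Φ X W Hr Hs)⁻¹.map conj) ∧
      (∃ C : Matrix (Fin K × Fin N) ({m : Fin M // m ≠ 0} × Fin N) ℂ,
        (RISChannel.Psi μ σ Φ X W Hr Hs)⁻¹ =
          Matrix.fromBlocks (RISChannel.crbHr μ σ Φ X W Hr Hs) C Cᴴ
            (RISChannel.crbHs μ σ Φ X W Hr Hs)) ∧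
      IsUnit (RISChannel.Psi1 (K := K) σ Φ Hs).det ∧
      IsUnit (RISChannel.Psi3 (M := M) σ Φ Hr).det ∧
      IsUnit (RISChannel.Psi1 (K := K) σ Φ Hs - RISChannel.Psi2 μ σ Φ X W Hr Hs *
        (RISChannel.Psi3 (M := M) σ Φ Hr)⁻¹ * (RISChannel.Psi2 μ σ Φ X W Hr Hs)ᴴ).det ∧
      IsUnit (RISChannel.Psi3 (M := M) σ Φ Hr - (RISChannel.Psi2 μ σ Φ X W Hr Hs)ᴴ *
        (RISChannel.Psi1 (K := K) σ Φ Hs)⁻¹ * RISChannel.Psi2 μ σ Φ X W Hr Hs).det ∧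
      RISChannel.crbHr μ σ Φ X W Hr Hs =
        (RISChannel.Psi1 (K := K) σ Φ Hs - RISChannel.Psi2 μ σ Φ X W Hr Hs *
          (RISChannel.Psi3 (M := M) σ Φ Hr)⁻¹ * (RISChannel.Psi2 μ σ Φ X W Hr Hs)ᴴ)⁻¹ ∧
      RISChannel.crbHs μ σ Φ X W Hr Hs =
        (RISChannel.Psi3 (M := M) σ Φ Hr - (RISChannel.Psi2 μ σ Φ X W Hr Hs)ᴴ *
          (RISChannel.Psi1 (K := K) σ Φ Hs)⁻¹ * RISChannel.Psi2 μ σ Φ X W Hr Hs)⁻¹ ∧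
      -- they are lower bounds for the error covariance of unbiased estimators
      (∀ est : RISChannel.Tensor K M P → Fin K × Fin N → ℂ,
        RISChannel.IsLocallyUnbiased μ Φ X W Hr Hs Sum.inl est →
        (RISChannel.errorCov μ Φ X W Hr Hs Sum.inl est -
          RISChannel.crbHr μ σ Φ X W Hr Hs).PosSemidef) ∧
      (∀ est : RISChannel.Tensor K M P → {m : Fin M // m ≠ 0} × Fin N → ℂ,
        RISChannel.IsLocallyUnbiased μ Φ X W Hr Hs Sum.inr est →
        (RISChannel.errorCov μ Φ X W Hr Hs Sum.inr est -
          RISChannel.crbHs μ σ Φ X W Hr Hs).PosSemidef)) := by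
  have hfisher := RISChannel.fisherInfo_eq hσ hX hWlaw hWindep Φ Hr hHs
  refine ⟨RISChannel.map_observation_eq_withDensity hσ hX hWlaw hWindep Φ Hr Hs,
    RISChannel.memLp_score hσ hX hWlaw Φ Hr hHs, hfisher,
    RISChannel.noiseCrossCov_apply hX hWlaw hWindep, fun hdet => ?_⟩
  rw [hfisher] at hdet
  obtain ⟨hΨdet, hinv⟩ := RISChannel.isUnit_det_and_inv_fromBlocks_map_conj hdet
  rw [← hfisher] at hinv
  have hpos := RISChannel.posDef_Psi_of_isUnit hσ hX hWlaw hWindep hΨdet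
  have hr : RISChannel.crbHr μ σ Φ X W Hr Hs =
      (RISChannel.Psi μ σ Φ X W Hr Hs)⁻¹.toBlocks₁₁ := by
    rw [RISChannel.crbHr, hinv, Matrix.toBlocks_fromBlocks₁₁]
  have hs : RISChannel.crbHs μ σ Φ X W Hr Hs =
      (RISChannel.Psi μ σ Φ X W Hr Hs)⁻¹.toBlocks₂₂ := by
    rw [RISChannel.crbHs, hinv, Matrix.toBlocks_fromBlocks₁₁]
  have h1 : (RISChannel.Psi1 (K := K) σ Φ Hs).PosDef := hpos.submatrix Sum.inl_injective
  have h3 : (RISChannel.Psi3 (M := M) σ Φ Hr).PosDef := hpos.submatrix Sum.inr_injective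
  obtain ⟨hS1, hS1inv⟩ := RISChannel.schur_fromBlocks₂₂ hpos.isUnit h3.isUnit
  obtain ⟨hS3, hS3inv⟩ := RISChannel.schur_fromBlocks₁₁ hpos.isUnit h1.isUnit
  refine ⟨hΨdet, hinv, ⟨(RISChannel.Psi μ σ Φ X W Hr Hs)⁻¹.toBlocks₁₂, ?_⟩,
    (Matrix.isUnit_iff_isUnit_det _).1 h1.isUnit, (Matrix.isUnit_iff_isUnit_det _).1 h3.isUnit,
    hS1, hS3, hr.trans hS1inv, hs.trans hS3inv, fun est hest => ?_, fun est hest => ?_⟩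
  · have hherm : (RISChannel.Psi μ σ Φ X W Hr Hs)⁻¹.toBlocks₂₁ =
        ((RISChannel.Psi μ σ Φ X W Hr Hs)⁻¹.toBlocks₁₂)ᴴ := by
      ext i j
      exact (hpos.inv.isHermitian.apply (Sum.inr i) (Sum.inl j)).symm
    rw [hr, hs, ← hherm, Matrix.fromBlocks_toBlocks]
  · rw [hr]
    exact hest.posSemidef_errorCov_sub hσ hX hWlaw hWindep hHs hpos
  · rw [hs]
    exact hest.posSemidef_errorCov_sub hσ hX hWlaw hWindep hHs hpos
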